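/- Let $F$ be a number field with algebraic closure $\overline F$ and ring of integers $\mathcal O_F$, let $E/F$ be an elliptic curve with conductor $N_{E/F}\subseteq\mathcal O_F$, and let $N>2$ be an integer. For $\alpha\in F^\times$ let $E^\alpha$ be the quadratic twist of $E$ by $\alpha$ (if $E: y^2=x^3+ax^2+bx+c$, then $E^\alpha:\alpha y^2=x^3+ax^2+bx+c$). Write $\rho_{E^\alpha,N}\colon \operatorname{Gal}(\overline F/F)\to \operatorname{Aut}_{\mathbb Z/N}(E^\alpha[N])\cong \operatorname{GL}(2,\mathbb Z/N\mathbb Z)$ for the Galois representation on the $N$-torsion points of $E^\alpha$ over $\overline F$. Let $T$ be the set of $\alpha\in F^\times$ such that $-\operatorname{Id}$ does not belong to the image of $\rho_{E^\alpha,N}$. Then: 1. For every $\alpha\in T$, $\sqrt\alpha\in F(E[N])$. 2. For every $\alpha\in T$, every prime ideal of $\mathcal O_F$ that ramifies in $F(\sqrt\alpha)/F$ divides $N$ or $N_{E/F}$. 3. There is a largest abelian extension $M/F$ (inside $\overline F$) of exponent dividing $2$ that is unramified outside the infinite places of $F$ and the primes dividing $N\cdot N_{E/F}$, and $F(\sqrt\alpha)\subseteq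 M$ for every $\alpha\in T$. 4. The image of $T$ in $F^\times/(F^\times)^2$ is finite. 5. Suppose that $F$ is a real quadratic field of class number $1$. Let $N_E$ be the absolute norm of $N_{E/F}$, let $\wp_1,\dots,\wp_n$ be the distinct prime ideals of $\mathcal O_F$ dividing the integer $N\cdot N_E$, let $\wp_i=(\pi_i)$ with $\pi_i\in\mathcal O_F$, and let $u_F$ be a fundamental unit, i.e. $\mathcal O_F^\times=\langle -1,u_F\rangle$. Then every $\alpha\in T$ is, up to multiplication by a square in $F^\times$, an element of $$\{\pm u_F^{k_0}\pi_1^{k_1}\cdots\pi_n^{k_n} : k_0,\dots,k_n\in\{0,1\}\}.$$ -/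

import Mathlib

open scoped NumberField

noncomputable section

namespace EllipticTwist

open IsDedekindDomain IntermediateField

section Torsion

variable {F : Type*} [Field F] (E : WeierstrassCurve F) (K : Type*) [Field K] [Algebra F K]

/-- The group `E(K)` of `K`-rational points. -/
abbrev Points : Type _ := (E.baseChange K).toAffine.Point

open Classical in
instance instAddCommGroupPoints : AddCommGroup (Points E K) := inferInstance

/-- The subgroup `E(K)[N]` of points killed by `N`. -/
abbrev torsion (N : ℕ) : AddSubgroup (Points E K) := AddSubgroup.torsionBy (Points E K) (N : ℤ)

instance instModuleTorsion (N : ℕ) : Module (ZMod N) (torsion E K N) :=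
  AddSubgroup.torsionBy.zmodModule

open Classical in
/-- The coordinatewise action of an automorphism `σ` of `K / F` on `E(K)`. -/
def galPoint (σ : K ≃ₐ[F] K) : Points E K →+ Points E K :=
  WeierstrassCurve.Affine.Point.map (W' := E) (σ : K →ₐ[F] K)

theorem galPoint_one (P : Points E K) : galPoint E K 1 P = P := by
  cases P <;> rfl

theorem galPoint_mul (σ τ : K ≃ₐ[F] K) (P : Points E K) :
    galPoint E K (σ * τ) P = galPoint E K σ (galPoint E K τ P) := by
  cases P <;> rfl

theorem galPoint_mem (N : ℕ) (σ : K ≃ₐ[F] K) {P : Points E K} (hP : P ∈ torsion E K N) :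
    galPoint E K σ P ∈ torsion E K N := by
  rw [AddSubgroup.torsionBy.nsmul_iff] at hP ⊢
  rw [← map_nsmul, hP, map_zero]

/-- The action of an automorphism `σ` of `K / F` on `E(K)[N]`. -/
def galTorsion (N : ℕ) (σ : K ≃ₐ[F] K) : torsion E K N →ₗ[ZMod N] torsion E K N :=
  AddMonoidHom.toZModLinearMap N
    (((galPoint E K σ).comp (torsion E K N).subtype).codRestrict (torsion E K N)
      fun P => galPoint_mem E K N σ P.2)

theorem galTorsion_one (N : ℕ) : galTorsion E K N 1 = 1 :=
  LinearMap.ext fun P => Subtype.ext (galPoint_one E K P)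

theorem galTorsion_mul (N : ℕ) (σ τ : K ≃ₐ[F] K) :
    galTorsion E K N (σ * τ) = galTorsion E K N σ * galTorsion E K N τ :=
  LinearMap.ext fun P => Subtype.ext (galPoint_mul E K σ τ P)

/-- The representation of `Aut(K / F)` on the `ℤ/N`-module `E(K)[N]`. -/
def torsionRep (N : ℕ) : (K ≃ₐ[F] K) →* LinearMap.GeneralLinearGroup (ZMod N) (torsion E K N) :=
  MonoidHom.toHomUnits
    { toFun := galTorsion E K N
      map_one' := galTorsion_one E K N
      map_mul' := galTorsion_mul E K N }

/-- The mod-`N` Galois representation `ρ_{E,N} : G_F → GL(E[N])`, where `E[N]` is the group of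
`N`-torsion points over an algebraic closure. For an elliptic curve over a field of characteristic
zero and `N ≥ 1`, a `ℤ/N`-basis of `E[N]` identifies the target with `GL(2, ℤ/N)`. -/
def galRep (N : ℕ) :
    (AlgebraicClosure F ≃ₐ[F] AlgebraicClosure F) →*
      LinearMap.GeneralLinearGroup (ZMod N) (torsion E (AlgebraicClosure F) N) :=
  torsionRep E (AlgebraicClosure F) N

/-- The `N`-division field `F(E[N])`, generated over `F` by the coordinates of all affine
`N`-torsion points over the algebraic closure. -/
def divisionField (N : ℕ) : IntermediateField F (AlgebraicClosure F) :=
  adjoin F {z | ∃ (x y : AlgebraicClosure F)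
    (h : (E.baseChange (AlgebraicClosure F)).toAffine.Nonsingular x y),
    (.some x y h : Points E (AlgebraicClosure F)) ∈ torsion E (AlgebraicClosure F) N ∧
      (z = x ∨ z = y)}

/-- The quadratic twist `E^α`, in characteristic different from `2`: completing the square turns
`E` into `y² = x³ + (b₂/4) x² + (b₄/2) x + b₆/4`, and `E^α` is the Weierstrass form of
`α y² = x³ + (b₂/4) x² + (b₄/2) x + b₆/4` in the coordinates `(α x, α² y)`. -/
def quadraticTwist (α : F) : WeierstrassCurve F where
  a₁ := 0
  a₂ := α * (E.b₂ / 4)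
  a₃ := 0
  a₄ := α ^ 2 * (E.b₄ / 2)
  a₆ := α ^ 3 * (E.b₆ / 4)

end Torsion

section Ramification

variable {F : Type*} [Field F] [NumberField F]

/-- The prime `v` of `F` ramifies in the extension `L / F` of number fields: some prime of `L`
above `v` has ramification index greater than `1`. -/
def RamifiesIn (v : HeightOneSpectrum (𝓞 F)) (L : Type*) [Field L] [Algebra F L] : Prop :=
  ∃ P : Ideal (𝓞 L), P.IsPrime ∧ P.LiesOver v.asIdeal ∧ 1 < P.ramificationIdx (𝓞 F)

/-- The algebraic extension `L / F` is unramified at every finite prime of `F` not dividing `𝔫`,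
that is, each of its finite subextensions is. Nothing is required at the infinite places. -/
def IsUnramifiedOutside (𝔫 : Ideal (𝓞 F)) (L : IntermediateField F (AlgebraicClosure F)) : Prop :=
  ∀ K : IntermediateField F (AlgebraicClosure F), K ≤ L → FiniteDimensional F K →
    ∀ v : HeightOneSpectrum (𝓞 F), RamifiesIn v K → v.asIdeal ∣ 𝔫

/-- `L / F` is an abelian extension of exponent (dividing) `2`. -/
structure IsAbelianOfExponentTwo (L : IntermediateField F (AlgebraicClosure F)) : Prop where
  isGalois : IsGalois F L
  comm : ∀ σ τ : L ≃ₐ[F] L, σ * τ = τ * σ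
  sq_eq_one : ∀ σ : L ≃ₐ[F] L, σ ^ 2 = 1

end Ramification

section Conductor

variable {F : Type*} [Field F] [NumberField F] (E : WeierstrassCurve F)

/-- The discrete valuation ring of the elements of `F` that are integral at `v`. -/
abbrev localRing (v : HeightOneSpectrum (𝓞 F)) : ValuationSubring F :=
  (v.valuation F).valuationSubring

instance instDVRLocalRing (v : HeightOneSpectrum (𝓞 F)) :
    IsDiscreteValuationRing (localRing v) :=
  (v.valuation F).valuationSubring_isDiscreteValuationRing

/-- The `i`-th ramification group in lower numbering, at a prime `P` of `L`: the automorphisms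
of `L / F` that act trivially on `𝓞 L` modulo `P ^ (i + 1)`. -/
def ramificationGroup {L : Type*} [Field L] [Algebra F L] (P : Ideal (𝓞 L)) (i : ℕ) :
    Subgroup (L ≃ₐ[F] L) :=
  (P ^ (i + 1)).toAddSubgroup.inertia (L ≃ₐ[F] L)

/-- The subspace of `E(K)[N]` fixed by a group `G` of automorphisms of `K / F`. -/
def fixedTorsion (K : Type*) [Field K] [Algebra F K] (N : ℕ) (G : Subgroup (K ≃ₐ[F] K)) :
    Submodule (ZMod N) (torsion E K N) :=
  ⨅ σ ∈ G, LinearMap.eqLocus (galTorsion E K N σ) LinearMap.id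

open Classical in
/-- A rational prime different from the residue characteristic of `v`. -/
def auxPrime (v : HeightOneSpectrum (𝓞 F)) : ℕ := if (2 : 𝓞 F) ∈ v.asIdeal then 3 else 2

theorem exists_prime_above (v : HeightOneSpectrum (𝓞 F))
    (L : IntermediateField F (AlgebraicClosure F)) :
    ∃ P : Ideal (𝓞 L), P.IsPrime ∧ P.LiesOver v.asIdeal := by
  obtain ⟨⟨P, hP, hPv⟩⟩ := v.asIdeal.nonempty_primesOver (S := 𝓞 L)
  exact ⟨P, hP, hPv⟩

/-- A prime of `L` above `v`. -/
def primeAbove (v : HeightOneSpectrum (𝓞 F)) (L : IntermediateField F (AlgebraicClosure F)) :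
    Ideal (𝓞 L) :=
  (exists_prime_above v L).choose

/-- The wild part `δ_v = ∑_{i ≥ 1} (g_i / g_0) dim (E[ℓ] / E[ℓ]^{G_i})` of the conductor exponent,
where `ℓ` is a prime different from the residue characteristic of `v`, `L = F(E[ℓ])`, `G_i` are
the ramification groups of `L / F` at a prime above `v`, and `g_i = #G_i`. Almost all terms vanish,
and the value is an integer (so that the division below is exact) which depends neither on `ℓ` nor
on the prime above `v`. All `ℓ`-torsion points are defined over `L`. -/
def wildExponent (v : HeightOneSpectrum (𝓞 F)) : ℕ :=
  let ℓ := auxPrime v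
  let L := divisionField E ℓ
  let G : ℕ → Subgroup (L ≃ₐ[F] L) := ramificationGroup (primeAbove v L)
  (∑ᶠ i : ℕ, Nat.card (G (i + 1)) *
    Module.finrank (ZMod ℓ) (torsion E L ℓ ⧸ fixedTorsion E L ℓ (G (i + 1)))) / Nat.card (G 0)

open Classical in
/-- The exponent of the conductor of `E` at `v`: `0` if `E` has good reduction at `v`, `1` if it has
multiplicative reduction, and `2 + δ_v` if it has additive reduction. -/
def conductorExponent (v : HeightOneSpectrum (𝓞 F)) : ℕ :=
  if (E.minimal (localRing v)).HasGoodReduction (localRing v) then 0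
  else if (E.minimal (localRing v)).HasMultiplicativeReduction (localRing v) then 1
  else 2 + wildExponent E v

/-- The conductor `N_{E/F}` of the elliptic curve `E / F`, an ideal of `𝓞 F`. Only the finitely many
primes of bad reduction contribute to the product. -/
def conductor : Ideal (𝓞 F) :=
  ∏ᶠ v : HeightOneSpectrum (𝓞 F), v.asIdeal ^ conductorExponent E v

end Conductor

/-- The property of `α ∈ F^×` that `-Id` does not belong to the image of `ρ_{E^α,N}`. -/
def TwistImageMissesNegOne {F : Type*} [Field F] (E : WeierstrassCurve F) (N : ℕ) (α : Fˣ) : Prop :=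
  -1 ∉ (galRep (quadraticTwist E (α : F)) N).range

/-- The set `{± u^{k₀} π₁^{k₁} ⋯ πₙ^{kₙ} : k₀, …, kₙ ∈ {0, 1}}`. -/
def twistSet {F : Type*} [Field F] (u : (𝓞 F)ˣ) {n : ℕ} (π : Fin n → 𝓞 F) : Set (𝓞 F) :=
  {a | ∃ (ε : 𝓞 F) (k₀ : Fin 2) (k : Fin n → Fin 2), (ε = 1 ∨ ε = -1) ∧
    a = ε * (u : 𝓞 F) ^ (k₀ : ℕ) * ∏ i, π i ^ (k i : ℕ)}

end EllipticTwist

end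

/-!
Over `F(√α)` the curves `E` and `E^α` become isomorphic, and conjugating the isomorphism by `σ`
multiplies it by the sign `σ √α / √α`. If `σ` fixes `F(E[N])` and moves `√α`, it therefore acts as
`-1` on `E^α[N]`; so `√α ∈ F(E[N])` for every `α` such that `-1` is not in the image of
`ρ_{E^α,N}`.

The extension `F(E[N]) / F` is unramified at a prime `v` of good reduction not dividing `N`. An
element `σ` of an inertia group above `v` does not change the reduction of a point `P`, so for
`P ∈ E[N]` the difference of `P` and `σ P` is an `N`-torsion point in the kernel of reduction. That
kernel has no `N`-torsion: there the parameter `t = x / y` of `N P` is `N t` up to terms of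
valuation at most `v t ^ 2`. Since ramification is detected by the inertia groups of finite Galois
extensions, composita of unramified extensions are unramified, and the largest extension of
exponent `2` is the compositum of all of them.

Hence the class of `α` modulo squares lies in the `2`-Selmer group of `F` with respect to the primes
dividing `N` or the conductor, which is finite because the class group is finite and the unit group
finitely generated. For class number one, it is generated by the units and by generators of those
primes.
-/

namespace EllipticTwist

open IsDedekindDomain IntermediateField

section VariableChange

open WeierstrassCurve WeierstrassCurve.Affine

section Coordinates

variable {R : Type*} [CommRing R] (W : WeierstrassCurve R) (C : VariableChange R)

/-- The `x`-coordinate on `W` of the point of `C • W` with `x`-coordinate `x`. -/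
def changeX (x : R) : R :=
  C.u ^ 2 * x + C.r

/-- The `y`-coordinate on `W` of the point `(x, y)` of `C • W`. -/
def changeY (x y : R) : R :=
  C.u ^ 3 * y + C.u ^ 2 * C.s * x + C.t

variable {C} in
theorem changeX_inj {x x' : R} : changeX C x = changeX C x' ↔ x = x' := by
  rw [changeX, changeX, add_left_inj, ← Units.val_pow_eq_pow_val, Units.mul_right_inj]

variable {C} in
theorem changeY_inj {x y y' : R} : changeY C x y = changeY C x y' ↔ y = y' := by
  rw [changeY, changeY, add_left_inj, add_left_inj, ← Units.val_pow_eq_pow_val,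
    Units.mul_right_inj]

theorem nonsingular_zero_smul_iff (u : Rˣ) (s : R) :
    ((⟨u, 0, s, 0⟩ : VariableChange R) • W).toAffine.Nonsingular 0 0 ↔
      W.toAffine.Nonsingular 0 0 := by
  simp only [nonsingular_zero, variableChange_def, zero_mul, add_zero, mul_zero, sub_zero,
    ← not_and_or, ← Units.val_pow_eq_pow_val, Units.mul_right_eq_zero]
  simp +contextual

theorem smul_nonsingular_iff (x y : R) :
    (C • W).toAffine.Nonsingular x y ↔
      W.toAffine.Nonsingular (changeX C x) (changeY C x y) := by
  have hC : (⟨1, x, 0, y⟩ * C : VariableChange R) =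
      ⟨C.u, 0, C.s, 0⟩ * ⟨1, changeX C x, 0, changeY C x y⟩ := by
    simp only [VariableChange.mul_def, changeX, changeY]
    ext <;> simp <;> ring
  rw [nonsingular_iff_variableChange, nonsingular_iff_variableChange (changeX C x), toAffine,
    smul_smul, hC, mul_smul, nonsingular_zero_smul_iff]

theorem negY_change (x y : R) :
    W.toAffine.negY (changeX C x) (changeY C x y) =
      changeY C x ((C • W).toAffine.negY x y) := by
  have hu : (C.u : R) * ↑C.u⁻¹ = 1 := C.u.mul_inv
  simp only [negY, variableChange_def, changeX, changeY]
  linear_combination C.u ^ 2 * (W.a₁ + 2 * C.s) * x * hu + (W.a₃ + C.r * W.a₁ + 2 * C.t) *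
    ((C.u * ↑C.u⁻¹) ^ 2 + C.u * ↑C.u⁻¹ + 1) * hu

end Coordinates

variable {K : Type*} [Field K] [DecidableEq K] (W : WeierstrassCurve K) (C : VariableChange K)

theorem slope_change_of_X_ne {x₁ x₂ : K} (y₁ y₂ : K) (hx : x₁ ≠ x₂) :
    W.toAffine.slope (changeX C x₁) (changeX C x₂) (changeY C x₁ y₁) (changeY C x₂ y₂) =
      C.u * (C • W).toAffine.slope x₁ x₂ y₁ y₂ + C.s := by
  have hd : changeX C x₁ - changeX C x₂ ≠ 0 := sub_ne_zero.2 (changeX_inj.not.2 hx)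
  rw [slope_of_X_ne hx, slope_of_X_ne (changeX_inj.not.2 hx), div_eq_iff hd]
  have := sub_ne_zero.2 hx
  simp only [changeX, changeY]
  field_simp
  ring

theorem slope_change_of_Y_ne {x y : K} (hy : y ≠ (C • W).toAffine.negY x y) :
    W.toAffine.slope (changeX C x) (changeX C x) (changeY C x y) (changeY C x y) =
      C.u * (C • W).toAffine.slope x x y y + C.s := by
  have hY : changeY C x y ≠ W.toAffine.negY (changeX C x) (changeY C x y) := by
    rwa [negY_change, Ne, changeY_inj]
  rw [slope_of_Y_ne rfl hy, slope_of_Y_ne rfl hY, div_eq_iff (sub_ne_zero.2 hY), negY_change]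
  have hd := sub_ne_zero.2 hy
  set d := y - (C • W).toAffine.negY x y with hd_def
  have hsub : changeY C x y - changeY C x ((C • W).toAffine.negY x y) = C.u ^ 3 * d := by
    simp only [changeY]
    ring
  rw [hsub]
  field_simp
  simp only [hd_def, changeX, changeY, negY, variableChange_def, Units.val_inv_eq_inv_val]
  field_simp
  ring

theorem slope_change {x₁ x₂ y₁ y₂ : K} (h₁ : (C • W).toAffine.Equation x₁ y₁)
    (h₂ : (C • W).toAffine.Equation x₂ y₂)
    (hxy : ¬(x₁ = x₂ ∧ y₁ = (C • W).toAffine.negY x₂ y₂)) :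
    W.toAffine.slope (changeX C x₁) (changeX C x₂) (changeY C x₁ y₁) (changeY C x₂ y₂) =
      C.u * (C • W).toAffine.slope x₁ x₂ y₁ y₂ + C.s := by
  by_cases hx : x₁ = x₂
  · subst hx
    have hy : y₁ ≠ (C • W).toAffine.negY x₁ y₂ := fun hy ↦ hxy ⟨rfl, hy⟩
    obtain rfl := Y_eq_of_Y_ne h₁ h₂ rfl hy
    exact slope_change_of_Y_ne W C hy
  · exact slope_change_of_X_ne W C y₁ y₂ hx

omit [DecidableEq K] in
theorem addX_change (x₁ x₂ ℓ : K) :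
    W.toAffine.addX (changeX C x₁) (changeX C x₂) (C.u * ℓ + C.s) =
      changeX C ((C • W).toAffine.addX x₁ x₂ ℓ) := by
  simp only [addX, changeX, variableChange_def, Units.val_inv_eq_inv_val]
  field_simp
  ring

omit [DecidableEq K] in
theorem addY_change (x₁ x₂ y₁ ℓ : K) :
    W.toAffine.addY (changeX C x₁) (changeX C x₂) (changeY C x₁ y₁) (C.u * ℓ + C.s) =
      changeY C ((C • W).toAffine.addX x₁ x₂ ℓ) ((C • W).toAffine.addY x₁ x₂ y₁ ℓ) := by
  rw [addY, addY, ← negY_change, addX_change]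
  congr 1
  simp only [negAddY, addX_change]
  simp only [changeX, changeY]
  ring

variable {W} in
/-- The homomorphism `(x, y) ↦ (u² x + r, u³ y + u² s x + t)` from the points of `C • W` to those
of `W`. The curve `C • W` is given by an equation, so that it can be a base change. -/
def changePoint {W' : WeierstrassCurve K} (h : W' = C • W) :
    W'.toAffine.Point →+ W.toAffine.Point where
  toFun
    | .zero => 0
    | .some x y hP => .some (changeX C x) (changeY C x y)
        ((smul_nonsingular_iff W C x y).1 (h ▸ hP))
  map_zero' := rfl
  map_add' := by
    subst h
    rintro (_ | ⟨x₁, y₁, h₁⟩) (_ | ⟨x₂, y₂, h₂⟩)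
    any_goals rfl
    by_cases hxy : x₁ = x₂ ∧ y₁ = (C • W).toAffine.negY x₂ y₂
    · rw [Point.add_of_Y_eq hxy.1 hxy.2]
      refine (Point.add_of_Y_eq (changeX_inj.2 hxy.1) ?_).symm
      rw [negY_change, hxy.1, hxy.2]
    · have hxy' : ¬(changeX C x₁ = changeX C x₂ ∧ changeY C x₁ y₁ =
          W.toAffine.negY (changeX C x₂) (changeY C x₂ y₂)) := by
        rintro ⟨hx, hy⟩
        obtain rfl := changeX_inj.1 hx
        rw [negY_change, changeY_inj] at hy
        exact hxy ⟨rfl, hy⟩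
      rw [Point.add_some hxy]
      refine Eq.trans ?_ (Point.add_some hxy').symm
      simp only [slope_change W C h₁.1 h₂.1 hxy, addX_change, addY_change]

variable {W} in
theorem changePoint_injective {W' : WeierstrassCurve K} (h : W' = C • W) :
    Function.Injective (changePoint C h) := by
  refine (injective_iff_map_eq_zero _).2 ?_
  rintro (_ | ⟨x, y, hP⟩) h0
  · rfl
  · exact absurd h0 (Point.some_ne_zero _)

end VariableChange

section Twist

open WeierstrassCurve

variable {F : Type*} [Field F] (E : WeierstrassCurve F) {K : Type*} [Field K] [Algebra F K]

theorem map_mem_torsion {E E' : WeierstrassCurve F} {N : ℕ} (f : Points E' K →+ Points E K)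
    {P : Points E' K} (hP : P ∈ torsion E' K N) : f P ∈ torsion E K N := by
  rw [AddSubgroup.torsionBy.nsmul_iff] at hP ⊢
  rw [← map_nsmul, hP, map_zero]

theorem some_congr {W : WeierstrassCurve K} {x y x' y' : K} (hx : x = x') (hy : y = y')
    (h : W.toAffine.Nonsingular x y) (h' : W.toAffine.Nonsingular x' y') :
    (.some x y h : W.toAffine.Point) = .some x' y' h' := by
  subst hx hy
  rfl

theorem galPoint_eq_self_of_smul {C : VariableChange F} {N : ℕ} {σ : K ≃ₐ[F] K}
    (hσ : ∀ P ∈ torsion (C • E) K N, galPoint (C • E) K σ P = P) {P : Points E K}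
    (hP : P ∈ torsion E K N) : galPoint E K σ P = P := by
  classical
  have hC : E.baseChange K = C⁻¹.map (algebraMap F K) • (C • E).baseChange K := by
    simp only [WeierstrassCurve.baseChange, map_variableChange, inv_smul_smul]
  let f : Points E K →+ Points (C • E) K := changePoint (C⁻¹.map (algebraMap F K)) hC
  have hf : Function.Injective f := changePoint_injective _ hC
  have hcomm : f (galPoint E K σ P) = galPoint (C • E) K σ (f P) := by
    rcases P with (_ | ⟨x, y, hxy⟩)
    · rfl
    · refine some_congr ?_ ?_ _ _ <;> simp [changeX, changeY, VariableChange.map]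
  exact hf (hcomm.trans (hσ _ (map_mem_torsion f hP)))

theorem baseChange_quadraticTwist [NeZero (2 : F)] {α : F} {β : Kˣ}
    (hβ : (β : K) ^ 2 = algebraMap F K α) :
    (quadraticTwist E α).baseChange K = (⟨β⁻¹, 0, algebraMap F K (-E.a₁ / 2),
      algebraMap F K (-E.a₃ / 2)⟩ : VariableChange K) • E.baseChange K := by
  have h2 : (2 : K) ≠ 0 := by
    rw [← map_ofNat (algebraMap F K) 2]
    exact (map_ne_zero _).2 two_ne_zero
  have h4 : (4 : K) ≠ 0 := by
    rw [show (4 : K) = 2 * 2 by norm_num]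
    exact mul_ne_zero h2 h2
  rw [variableChange_def]
  ext <;> simp only [quadraticTwist, WeierstrassCurve.baseChange, map_a₁, map_a₂, map_a₃, map_a₄,
    map_a₆, map_mul, map_pow, map_div₀, map_neg, map_ofNat, map_zero, inv_inv, ← hβ, b₂, b₄, b₆,
    map_add] <;> field_simp <;> ring

theorem galPoint_quadraticTwist_eq_neg [NeZero (2 : F)] {α : F} {β : K} (hβ0 : β ≠ 0)
    (hβ : β ^ 2 = algebraMap F K α) {N : ℕ} {σ : K ≃ₐ[F] K} (hσβ : σ β = -β)
    (hσ : ∀ P ∈ torsion E K N, galPoint E K σ P = P) {P : Points (quadraticTwist E α) K}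
    (hP : P ∈ torsion (quadraticTwist E α) K N) : galPoint (quadraticTwist E α) K σ P = -P := by
  classical
  have hC := baseChange_quadraticTwist E (β := Units.mk0 β hβ0) hβ
  let f : Points (quadraticTwist E α) K →+ Points E K := changePoint _ hC
  have hf : Function.Injective f := changePoint_injective _ hC
  have hcomm : f (galPoint (quadraticTwist E α) K σ P) = galPoint E K σ (f (-P)) := by
    rcases P with (_ | ⟨x, y, hxy⟩)
    · rfl
    · refine some_congr ?_ ?_ _ _ <;>
        simp [changeX, changeY, Affine.negY, quadraticTwist, hσβ, Odd.neg_pow (by decide : Odd 3)]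
  exact hf (hcomm.trans (hσ _ (map_mem_torsion f (neg_mem hP))))

theorem galPoint_eq_self_of_mem_fixingSubgroup {N : ℕ}
    {σ : AlgebraicClosure F ≃ₐ[F] AlgebraicClosure F}
    (hσ : σ ∈ (divisionField E N).fixingSubgroup) {P : Points E (AlgebraicClosure F)}
    (hP : P ∈ torsion E (AlgebraicClosure F) N) : galPoint E (AlgebraicClosure F) σ P = P := by
  rw [IntermediateField.mem_fixingSubgroup_iff] at hσ
  rcases P with (_ | ⟨x, y, h⟩)
  · rfl
  · exact some_congr (hσ x (subset_adjoin _ _ ⟨x, y, h, hP, Or.inl rfl⟩))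
      (hσ y (subset_adjoin _ _ ⟨x, y, h, hP, Or.inr rfl⟩)) _ _

theorem mem_of_forall_mem_fixingSubgroup [PerfectField F]
    {L : IntermediateField F (AlgebraicClosure F)} {x : AlgebraicClosure F}
    (h : ∀ σ ∈ L.fixingSubgroup, σ x = x) : x ∈ L := by
  rw [← InfiniteGalois.fixedField_fixingSubgroup L]
  exact fun σ ↦ h σ σ.2

theorem apply_eq_or_eq_neg_of_sq_eq {α : F} {β : K} (hβ : β ^ 2 = algebraMap F K α)
    (σ : K ≃ₐ[F] K) : σ β = β ∨ σ β = -β :=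
  sq_eq_sq_iff_eq_or_eq_neg.1 (by rw [← map_pow, hβ, AlgEquiv.commutes])

theorem mem_divisionField_of_twistImageMissesNegOne [NeZero (2 : F)] [PerfectField F] {N : ℕ}
    {α : Fˣ} (hα : TwistImageMissesNegOne E N α) {β : AlgebraicClosure F}
    (hβ : β ^ 2 = algebraMap F (AlgebraicClosure F) α) : β ∈ divisionField E N := by
  have hβ0 : β ≠ 0 := by
    rw [← pow_ne_zero_iff two_ne_zero, hβ]
    exact (map_ne_zero _).2 α.ne_zero
  refine mem_of_forall_mem_fixingSubgroup fun σ hσ ↦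
    (apply_eq_or_eq_neg_of_sq_eq hβ σ).resolve_right fun hσβ ↦ hα ⟨σ, ?_⟩
  refine Units.ext (LinearMap.ext fun P ↦ Subtype.ext ?_)
  exact galPoint_quadraticTwist_eq_neg E hβ0 hβ hσβ
    (fun _ ↦ galPoint_eq_self_of_mem_fixingSubgroup E hσ) P.2

end Twist

section Reduction

open WeierstrassCurve WeierstrassCurve.Affine

variable {K : Type*} [Field K] {Γ₀ : Type*} [LinearOrderedCommGroupWithZero Γ₀]
  {v : Valuation K Γ₀}

variable (v) in
/-- The Weierstrass equation `W` has coefficients in the valuation ring of `v`. -/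
structure IsIntegralAt (W : WeierstrassCurve K) : Prop where
  a₁ : v W.a₁ ≤ 1
  a₂ : v W.a₂ ≤ 1
  a₃ : v W.a₃ ≤ 1
  a₄ : v W.a₄ ≤ 1
  a₆ : v W.a₆ ≤ 1

theorem val_mul_le {x y : K} {c : Γ₀} (hx : v x ≤ 1) (hy : v y ≤ c) : v (x * y) ≤ c := by
  rw [map_mul]
  exact (mul_le_mul' hx hy).trans_eq (one_mul c)

theorem val_mul_lt_one {x y : K} (hx : v x ≤ 1) (hy : v y < 1) : v (x * y) < 1 := by
  rw [map_mul]
  exact mul_lt_one_of_nonneg_of_lt_one_right hx zero_le hy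

theorem val_mul_le_sq {x y : K} {c : Γ₀} (hx : v x ≤ c) (hy : v y ≤ c) : v (x * y) ≤ c ^ 2 := by
  rw [map_mul, sq]
  exact mul_le_mul' hx hy

theorem val_natCast_le_one (n : ℕ) : v (n : K) ≤ 1 :=
  natCast_mem v.integer n

theorem val_ofNat_le_one (n : ℕ) [n.AtLeastTwo] : v (OfNat.ofNat n : K) ≤ 1 :=
  val_natCast_le_one n

theorem ne_zero_of_val_eq_one {x : K} (hx : v x = 1) : x ≠ 0 :=
  v.ne_zero_iff.1 (hx.trans_ne one_ne_zero)

theorem val_lt_val_sq {x : K} (hx : 1 < v x) : v x < v (x ^ 2) := by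
  rw [map_pow]
  exact lt_self_pow₀ hx one_lt_two

variable {W : WeierstrassCurve K}

theorem val_Δ_lt_one (h₁ : v W.a₁ ≤ 1) (h₂ : v W.a₂ ≤ 1) (h₃ : v W.a₃ < 1) (h₄ : v W.a₄ < 1)
    (h₆ : v W.a₆ < 1) : v W.Δ < 1 := by
  have hb₂ : v W.b₂ ≤ 1 := v.map_add_le (by rw [sq]; exact val_mul_le h₁ h₁)
    (val_mul_le (val_ofNat_le_one 4) h₂)
  have hb₄ : v W.b₄ < 1 := v.map_add_lt (val_mul_lt_one (val_ofNat_le_one 2) h₄)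
    (val_mul_lt_one h₁ h₃)
  have hb₆ : v W.b₆ < 1 := v.map_add_lt (by rw [sq]; exact val_mul_lt_one h₃.le h₃)
    (val_mul_lt_one (val_ofNat_le_one 4) h₆)
  have hb₈ : v W.b₈ < 1 := by
    rw [b₈, show W.a₁ ^ 2 * W.a₆ + 4 * W.a₂ * W.a₆ - W.a₁ * W.a₃ * W.a₄ + W.a₂ * W.a₃ ^ 2 -
      W.a₄ ^ 2 = W.b₂ * W.a₆ - W.a₁ * W.a₃ * W.a₄ + W.a₂ * W.a₃ * W.a₃ - W.a₄ * W.a₄ by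
        rw [b₂]; ring]
    exact v.map_sub_lt (v.map_add_lt (v.map_sub_lt (val_mul_lt_one hb₂ h₆)
      (val_mul_lt_one (val_mul_le h₁ h₃.le) h₄)) (val_mul_lt_one (val_mul_le h₂ h₃.le) h₃))
      (val_mul_lt_one h₄.le h₄)
  rw [Δ, show -W.b₂ ^ 2 * W.b₈ - 8 * W.b₄ ^ 3 - 27 * W.b₆ ^ 2 + 9 * W.b₂ * W.b₄ * W.b₆ =
    -(W.b₂ * W.b₂ * W.b₈) - 8 * W.b₄ * W.b₄ * W.b₄ - 27 * W.b₆ * W.b₆ +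
      9 * W.b₂ * W.b₄ * W.b₆ by ring]
  refine v.map_add_lt (v.map_sub_lt (v.map_sub_lt ?_ ?_) ?_) ?_
  · rw [v.map_neg]
    exact val_mul_lt_one (val_mul_le hb₂ hb₂) hb₈
  · exact val_mul_lt_one (val_mul_le (val_mul_le (val_ofNat_le_one 8) hb₄.le) hb₄.le) hb₄
  · exact val_mul_lt_one (val_mul_le (val_ofNat_le_one 27) hb₆.le) hb₆
  · exact val_mul_lt_one (val_mul_le (val_mul_le (val_ofNat_le_one 9) hb₂) hb₄.le) hb₆

theorem val_Δ_lt_one_of_singular (hW : IsIntegralAt v W) {x y : K} (hx : v x ≤ 1)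
    (h : W.toAffine.Equation x y) (hY : v (2 * y + W.a₁ * x + W.a₃) < 1)
    (hX : v (3 * x ^ 2 + 2 * W.a₂ * x + W.a₄ - W.a₁ * y) < 1) : v W.Δ < 1 := by
  have hΔ : ((⟨1, x, 0, y⟩ : VariableChange K) • W).Δ = W.Δ := by
    rw [variableChange_Δ, inv_one, Units.val_one, one_pow, one_mul]
  rw [← hΔ]
  rw [equation_iff_variableChange, equation_zero] at h
  refine val_Δ_lt_one ?_ ?_ ?_ ?_ ((congrArg v h).trans_lt ((map_zero v).trans_lt zero_lt_one)) <;>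
    simp only [variableChange_def, inv_one, Units.val_one, one_pow, one_mul, mul_zero, zero_mul,
      add_zero, sub_zero]
  · exact hW.a₁
  · simpa using v.map_add_le hW.a₂ (val_mul_le (val_ofNat_le_one 3) hx)
  · rwa [show W.a₃ + x * W.a₁ + 2 * y = 2 * y + W.a₁ * x + W.a₃ by ring]
  · convert hX using 2
    ring

theorem slope_mul_X_sub [DecidableEq K] {x₁ y₁ x₂ y₂ : K} (h₁ : W.toAffine.Equation x₁ y₁)
    (h₂ : W.toAffine.Equation x₂ y₂) (hxy : ¬ (x₁ = x₂ ∧ y₁ = W.toAffine.negY x₂ y₂)) :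
    W.toAffine.slope x₁ x₂ y₁ y₂ * (x₁ - x₂) = y₁ - y₂ := by
  by_cases hx : x₁ = x₂
  · rw [Y_eq_of_Y_ne h₁ h₂ hx fun hy ↦ hxy ⟨hx, hy⟩, hx, sub_self, mul_zero, sub_self]
  · rw [slope_of_X_ne hx, div_mul_cancel₀ _ (sub_ne_zero.2 hx)]

theorem slope_mul_Y_sub_negY [DecidableEq K] {x₁ y₁ x₂ y₂ : K} (h₁ : W.toAffine.Equation x₁ y₁)
    (h₂ : W.toAffine.Equation x₂ y₂) (hxy : ¬ (x₁ = x₂ ∧ y₁ = W.toAffine.negY x₂ y₂)) :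
    W.toAffine.slope x₁ x₂ y₁ y₂ * (y₁ + y₂ + W.a₁ * x₁ + W.a₃) =
      x₁ ^ 2 + x₁ * x₂ + x₂ ^ 2 + W.a₂ * (x₁ + x₂) + W.a₄ - W.a₁ * y₂ := by
  by_cases hx : x₁ = x₂
  · subst hx
    have hy : y₁ ≠ W.toAffine.negY x₁ y₂ := fun hy ↦ hxy ⟨rfl, hy⟩
    obtain rfl := Y_eq_of_Y_ne h₁ h₂ rfl hy
    rw [show y₁ + y₁ + W.a₁ * x₁ + W.a₃ = y₁ - W.toAffine.negY x₁ y₁ by rw [negY]; ring,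
      slope_of_Y_ne rfl hy, div_mul_cancel₀ _ (sub_ne_zero.2 hy)]
    ring
  · refine mul_right_cancel₀ (sub_ne_zero.2 hx) ?_
    linear_combination (y₁ + y₂ + W.a₁ * x₁ + W.a₃) * slope_mul_X_sub h₁ h₂ hxy +
      (equation_iff' _ _).1 h₁ - (equation_iff' _ _).1 h₂

/-- If the line had integral slope, its reduction would pass through a singular point. -/
theorem one_lt_val_slope [DecidableEq K] (hW : IsIntegralAt v W) (hΔ : v W.Δ = 1)
    {x₁ y₁ x₂ y₂ : K} (h₁ : W.toAffine.Equation x₁ y₁) (h₂ : W.toAffine.Equation x₂ y₂)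
    (hxy : ¬ (x₁ = x₂ ∧ y₁ = W.toAffine.negY x₂ y₂)) (hx₁ : v x₁ ≤ 1) (hx₂ : v x₂ ≤ 1)
    (hx : v (x₁ - x₂) < 1) (hy : v (y₁ + y₂ + W.a₁ * x₁ + W.a₃) < 1) :
    1 < v (W.toAffine.slope x₁ x₂ y₁ y₂) := by
  by_contra! hℓ
  have hX := slope_mul_X_sub h₁ h₂ hxy
  have hY := slope_mul_Y_sub_negY h₁ h₂ hxy
  set ℓ := W.toAffine.slope x₁ x₂ y₁ y₂
  refine (val_Δ_lt_one_of_singular hW hx₁ h₁ ?_ ?_).ne hΔ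
  · rw [show 2 * y₁ + W.a₁ * x₁ + W.a₃ = (y₁ + y₂ + W.a₁ * x₁ + W.a₃) + ℓ * (x₁ - x₂) by
      linear_combination -hX]
    exact v.map_add_lt hy (val_mul_lt_one hℓ hx)
  · rw [show 3 * x₁ ^ 2 + 2 * W.a₂ * x₁ + W.a₄ - W.a₁ * y₁ =
      ℓ * (y₁ + y₂ + W.a₁ * x₁ + W.a₃) + (2 * x₁ + x₂ + W.a₂ - W.a₁ * ℓ) * (x₁ - x₂) by
        linear_combination -hY + W.a₁ * hX]
    refine v.map_add_lt (val_mul_lt_one hℓ hy) (val_mul_lt_one ?_ hx)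
    exact v.map_sub_le (v.map_add_le (v.map_add_le (val_mul_le (val_ofNat_le_one 2) hx₁) hx₂)
      hW.a₂) (val_mul_le hW.a₁ hℓ)

theorem one_lt_val_addX (hW : IsIntegralAt v W) {x₁ x₂ ℓ : K} (hx₁ : v x₁ ≤ 1) (hx₂ : v x₂ ≤ 1)
    (hℓ : 1 < v ℓ) : 1 < v (W.toAffine.addX x₁ x₂ ℓ) := by
  have hlt := val_lt_val_sq hℓ
  rw [addX, show ℓ ^ 2 + W.a₁ * ℓ - W.a₂ - x₁ - x₂ = ℓ ^ 2 + (W.a₁ * ℓ - W.a₂ - x₁ - x₂) by ring,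
    v.map_add_eq_of_lt_left]
  · exact hℓ.trans hlt
  · refine lt_of_le_of_lt ?_ hlt
    exact v.map_sub_le (v.map_sub_le (v.map_sub_le (val_mul_le hW.a₁ le_rfl) (hW.a₂.trans hℓ.le))
      (hx₁.trans hℓ.le)) (hx₂.trans hℓ.le)

theorem exists_sub_eq_some_one_lt_val [DecidableEq K] (hW : IsIntegralAt v W) (hΔ : v W.Δ = 1)
    {x y x' y' : K} (hP : W.toAffine.Nonsingular x y) (hP' : W.toAffine.Nonsingular x' y')
    (hx : v x ≤ 1) (hx' : v x' ≤ 1) (hxx : v (x - x') < 1) (hyy : v (y - y') < 1)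
    (hne : (.some x y hP : W.toAffine.Point) ≠ .some x' y' hP') :
    ∃ (x₃ y₃ : K) (h₃ : W.toAffine.Nonsingular x₃ y₃), 1 < v x₃ ∧
      (.some x y hP : W.toAffine.Point) - .some x' y' hP' = .some x₃ y₃ h₃ := by
  have hxy : ¬ (x = x' ∧ y = W.toAffine.negY x' (W.toAffine.negY x' y')) := by
    rw [negY_negY]
    rintro ⟨rfl, rfl⟩
    exact hne rfl
  rw [sub_eq_add_neg, Point.neg_some, Point.add_some hxy]
  refine ⟨_, _, _, one_lt_val_addX hW hx hx' ?_, rfl⟩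
  refine one_lt_val_slope hW hΔ hP.1 ((nonsingular_neg x' y').2 hP').1 hxy hx hx' hxx ?_
  rw [show y + W.toAffine.negY x' y' + W.a₁ * x + W.a₃ = (y - y') + W.a₁ * (x - x') by
    rw [negY]; ring]
  exact v.map_add_lt hyy (val_mul_lt_one hW.a₁ hxx)

theorem val_Y_le_one (hW : IsIntegralAt v W) {x y : K} (h : W.toAffine.Equation x y)
    (hx : v x ≤ 1) : v y ≤ 1 := by
  by_contra! hy
  have hsq : y ^ 2 = x ^ 3 + W.a₂ * x ^ 2 + W.a₄ * x + W.a₆ - W.a₁ * x * y - W.a₃ * y := by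
    linear_combination (equation_iff _ _).1 h
  have hpow (n : ℕ) : v (x ^ n) ≤ 1 := (map_pow v x n).trans_le (pow_le_one' hx n)
  refine (val_lt_val_sq hy).not_ge ?_
  rw [hsq]
  refine v.map_sub_le (v.map_sub_le (le_trans ?_ hy.le) ?_) (val_mul_le hW.a₃ le_rfl)
  · exact v.map_add_le (v.map_add_le (v.map_add_le (hpow 3) (val_mul_le hW.a₂ (hpow 2)))
      (val_mul_le hW.a₄ hx)) hW.a₆
  · exact val_mul_le (val_mul_le hW.a₁ hx) le_rfl

theorem val_X_lt_val_Y (hW : IsIntegralAt v W) {x y : K} (h : W.toAffine.Equation x y)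
    (hx : 1 < v x) : v x < v y := by
  by_contra! hle
  have hsq := val_lt_val_sq hx
  have hxy : v (x * y) ≤ v (x ^ 2) := by
    rw [map_mul, map_pow, sq]
    exact mul_le_mul_right hle _
  have hcube : x ^ 3 = y * y + W.a₁ * (x * y) + W.a₃ * y - W.a₂ * x ^ 2 - W.a₄ * x - W.a₆ := by
    linear_combination -(equation_iff _ _).1 h
  have hlt : v (x ^ 2) < v (x ^ 3) := by
    rw [map_pow, map_pow]
    exact pow_lt_pow_right₀ hx (by norm_num)
  refine hlt.not_ge ?_
  rw [hcube]
  refine v.map_sub_le (v.map_sub_le (v.map_sub_le (v.map_add_le (v.map_add_le ?_ ?_) ?_) ?_) ?_) ?_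
  · exact (val_mul_le_sq hle hle).trans_eq (map_pow v x 2).symm
  · exact val_mul_le hW.a₁ hxy
  · exact val_mul_le hW.a₃ (hle.trans hsq.le)
  · exact val_mul_le hW.a₂ le_rfl
  · exact val_mul_le hW.a₄ hsq.le
  · exact hW.a₆.trans (hx.trans hsq).le

theorem val_Y_sq (hW : IsIntegralAt v W) {x y : K} (h : W.toAffine.Equation x y)
    (hx : 1 < v x) : v y ^ 2 = v x ^ 3 := by
  have hxy := val_X_lt_val_Y hW h hx
  have hL : v (y ^ 2 + (W.a₁ * x + W.a₃) * y) = v y ^ 2 := by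
    rw [v.map_add_eq_of_lt_left, map_pow]
    rw [map_mul, map_pow, sq]
    refine mul_lt_mul_of_pos_right ?_ (zero_lt_one.trans (hx.trans hxy))
    exact (v.map_add_le (val_mul_le hW.a₁ le_rfl) (hW.a₃.trans hx.le)).trans_lt hxy
  have hR : v (x ^ 3 + (W.a₂ * x ^ 2 + W.a₄ * x + W.a₆)) = v x ^ 3 := by
    rw [v.map_add_eq_of_lt_left, map_pow]
    have hsq := val_lt_val_sq hx
    refine lt_of_le_of_lt (b := v (x ^ 2)) ?_ ?_
    · exact v.map_add_le (v.map_add_le (val_mul_le hW.a₂ le_rfl) (val_mul_le hW.a₄ hsq.le))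
        (hW.a₆.trans (hx.trans hsq).le)
    · rw [map_pow, map_pow]
      exact pow_lt_pow_right₀ hx (by norm_num)
  rw [← hL, ← hR]
  congr 1
  linear_combination (equation_iff _ _).1 h

theorem Y_ne_zero_of_one_lt_val (hW : IsIntegralAt v W) {x y : K} (h : W.toAffine.Equation x y)
    (hx : 1 < v x) : y ≠ 0 :=
  v.ne_zero_iff.1 (zero_lt_one.trans (hx.trans (val_X_lt_val_Y hW h hx))).ne'

theorem val_X_div_Y_lt_one (hW : IsIntegralAt v W) {x y : K} (h : W.toAffine.Equation x y)
    (hx : 1 < v x) : v (x / y) < 1 := by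
  have hxy := val_X_lt_val_Y hW h hx
  rw [map_div₀]
  exact (div_lt_one₀ (zero_lt_one.trans (hx.trans hxy))).2 hxy

theorem val_Y_inv_le (hW : IsIntegralAt v W) {x y : K} (h : W.toAffine.Equation x y)
    (hx : 1 < v x) {τ : Γ₀} (hτ : v (x / y) ≤ τ) : v y⁻¹ ≤ τ ^ 2 := by
  have hy : v y ≠ 0 := v.ne_zero_iff.2 (Y_ne_zero_of_one_lt_val hW h hx)
  have hcube : v y⁻¹ = v (x / y) ^ 3 := by
    rw [map_inv₀, map_div₀, div_pow, ← val_Y_sq hW h hx]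
    field_simp
  rw [hcube]
  exact (pow_le_pow_right_of_le_one' (val_X_div_Y_lt_one hW h hx).le (by norm_num : 2 ≤ 3)).trans
    (pow_le_pow_left₀ zero_le hτ 2)

variable (W) in
/-- In the coordinates `t = x / y` and `w = 1 / y` at the origin, the chord through `(t₁, w₁)` and
`(t₂, w₂)` has slope `chordNum W t₁ t₂ w₂ / chordDen W t₁ w₁ w₂`; unlike `(w₂ - w₁) / (t₂ - t₁)`,
this also gives the slope of the tangent. -/
def chordNum (t₁ t₂ w₂ : K) : K :=
  t₁ * t₁ + t₁ * t₂ + t₂ * t₂ + (t₁ + t₂) * (W.a₂ * w₂) + W.a₄ * w₂ * w₂ - W.a₁ * w₂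

variable (W) in
/-- The denominator of the slope of a chord in the coordinates at the origin, see `chordNum`. -/
def chordDen (t₁ w₁ w₂ : K) : K :=
  1 + (W.a₁ * t₁ + W.a₃ * (w₁ + w₂) - W.a₂ * (t₁ * t₁) - W.a₄ * (t₁ * (w₁ + w₂)) -
    W.a₆ * (w₁ * w₁ + w₁ * w₂ + w₂ * w₂))

theorem equation_origin_coordinates {x y : K} (h : W.toAffine.Equation x y) (hy : y ≠ 0) :
    y⁻¹ + W.a₁ * (x / y) * y⁻¹ + W.a₃ * y⁻¹ ^ 2 = (x / y) ^ 3 + W.a₂ * (x / y) ^ 2 * y⁻¹ +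
      W.a₄ * (x / y) * y⁻¹ ^ 2 + W.a₆ * y⁻¹ ^ 3 := by
  field_simp
  linear_combination (equation_iff _ _).1 h

theorem val_chordNum_le (hW : IsIntegralAt v W) {t₁ t₂ w₂ : K} {τ : Γ₀} (hτ : τ ≤ 1)
    (ht₁ : v t₁ ≤ τ) (ht₂ : v t₂ ≤ τ) (hw₂ : v w₂ ≤ τ ^ 2) : v (chordNum W t₁ t₂ w₂) ≤ τ ^ 2 := by
  refine v.map_sub_le (v.map_add_le (v.map_add_le (v.map_add_le (v.map_add_le ?_ ?_) ?_) ?_) ?_)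
    (val_mul_le hW.a₁ hw₂)
  · exact val_mul_le_sq ht₁ ht₁
  · exact val_mul_le_sq ht₁ ht₂
  · exact val_mul_le_sq ht₂ ht₂
  · exact val_mul_le ((v.map_add_le ht₁ ht₂).trans hτ) (val_mul_le hW.a₂ hw₂)
  · exact val_mul_le (val_mul_le hW.a₄ (hw₂.trans (pow_le_one' hτ 2))) hw₂

theorem val_chordDen_eq_one (hW : IsIntegralAt v W) {t₁ w₁ w₂ : K} (ht₁ : v t₁ < 1)
    (hw₁ : v w₁ < 1) (hw₂ : v w₂ < 1) : v (chordDen W t₁ w₁ w₂) = 1 := by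
  have hw := v.map_add_lt hw₁ hw₂
  refine v.map_one_add_of_lt (v.map_sub_lt (v.map_sub_lt (v.map_sub_lt (v.map_add_lt
    (val_mul_lt_one hW.a₁ ht₁) (val_mul_lt_one hW.a₃ hw)) ?_) ?_) (val_mul_lt_one hW.a₆ ?_))
  · exact val_mul_lt_one hW.a₂ (val_mul_lt_one ht₁.le ht₁)
  · exact val_mul_lt_one hW.a₄ (val_mul_lt_one ht₁.le hw)
  · exact v.map_add_lt (v.map_add_lt (val_mul_lt_one hw₁.le hw₁) (val_mul_lt_one hw₁.le hw₂))
      (val_mul_lt_one hw₂.le hw₂)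

theorem slope_eq_of_mul_chordDen_eq_chordNum [DecidableEq K] {x₁ y₁ x₂ y₂ l : K}
    (h₁ : W.toAffine.Equation x₁ y₁) (h₂ : W.toAffine.Equation x₂ y₂)
    (hxy : ¬ (x₁ = x₂ ∧ y₁ = W.toAffine.negY x₂ y₂)) (hy₁ : y₁ ≠ 0) (hy₂ : y₂ ≠ 0)
    (hden : chordDen W (x₁ / y₁) y₁⁻¹ y₂⁻¹ ≠ 0)
    (hl : l * chordDen W (x₁ / y₁) y₁⁻¹ y₂⁻¹ = chordNum W (x₁ / y₁) (x₂ / y₂) y₂⁻¹) :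
    W.toAffine.slope x₁ x₂ y₁ y₂ = -l * (y₁ - W.toAffine.slope x₁ x₂ y₁ y₂ * x₁) := by
  have hX := slope_mul_X_sub h₁ h₂ hxy
  have hY := slope_mul_Y_sub_negY h₁ h₂ hxy
  set ℓ := W.toAffine.slope x₁ x₂ y₁ y₂
  rw [← sub_eq_zero]
  by_cases hx : x₁ = x₂
  · subst hx
    have hy : y₁ ≠ W.toAffine.negY x₁ y₂ := fun hy ↦ hxy ⟨rfl, hy⟩
    obtain rfl := Y_eq_of_Y_ne h₁ h₂ rfl hy
    have hl' : l * (y₁ ^ 2 + W.a₁ * x₁ * y₁ + 2 * W.a₃ * y₁ - W.a₂ * x₁ ^ 2 - 2 * W.a₄ * x₁ -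
        3 * W.a₆) = 3 * x₁ ^ 2 + 2 * W.a₂ * x₁ + W.a₄ - W.a₁ * y₁ := by
      rw [chordDen, chordNum] at hl
      field_simp at hl
      linear_combination hl
    refine (mul_eq_zero.1 ?_).resolve_left (sub_ne_zero.2 hy)
    rw [negY]
    linear_combination (1 - l * x₁) * hY - hl' + 3 * l * (equation_iff _ _).1 h₁
  · have hw : y₂⁻¹ - y₁⁻¹ = l * (x₂ / y₂ - x₁ / y₁) := by
      refine mul_right_cancel₀ hden ?_
      rw [mul_right_comm, hl, chordDen, chordNum]
      linear_combination equation_origin_coordinates h₂ hy₂ - equation_origin_coordinates h₁ hy₁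
    have hw' : y₁ - y₂ = l * (x₂ * y₁ - x₁ * y₂) := by
      field_simp at hw
      linear_combination hw
    refine (mul_eq_zero.1 ?_).resolve_left (sub_ne_zero.2 hx)
    linear_combination (1 - l * x₁) * hX + hw'

theorem exists_slope_eq_of_one_lt_val [DecidableEq K] (hW : IsIntegralAt v W) {x₁ y₁ x₂ y₂ : K}
    (h₁ : W.toAffine.Equation x₁ y₁) (h₂ : W.toAffine.Equation x₂ y₂)
    (hxy : ¬ (x₁ = x₂ ∧ y₁ = W.toAffine.negY x₂ y₂)) (hx₁ : 1 < v x₁) (hx₂ : 1 < v x₂)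
    {τ : Γ₀} (hτ : τ < 1) (ht₁ : v (x₁ / y₁) ≤ τ) (ht₂ : v (x₂ / y₂) ≤ τ) :
    ∃ l : K, v l ≤ τ ^ 2 ∧ W.toAffine.slope x₁ x₂ y₁ y₂ =
      -l * (y₁ - W.toAffine.slope x₁ x₂ y₁ y₂ * x₁) := by
  have hτ2 : τ ^ 2 < 1 := pow_lt_one₀ zero_le hτ two_ne_zero
  have hw₁ := val_Y_inv_le hW h₁ hx₁ ht₁
  have hw₂ := val_Y_inv_le hW h₂ hx₂ ht₂
  have hden := val_chordDen_eq_one hW (ht₁.trans_lt hτ) (hw₁.trans_lt hτ2) (hw₂.trans_lt hτ2)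
  have hden0 := ne_zero_of_val_eq_one hden
  refine ⟨chordNum W (x₁ / y₁) (x₂ / y₂) y₂⁻¹ / chordDen W (x₁ / y₁) y₁⁻¹ y₂⁻¹, ?_,
    slope_eq_of_mul_chordDen_eq_chordNum h₁ h₂ hxy (Y_ne_zero_of_one_lt_val hW h₁ hx₁)
      (Y_ne_zero_of_one_lt_val hW h₂ hx₂) hden0 (div_mul_cancel₀ _ hden0)⟩
  rw [map_div₀, hden, div_one]
  exact val_chordNum_le hW hτ.le ht₁ ht₂ hw₂

theorem Y_inv_eq_of_line {x y ℓ ν l : K} (hν : ν ≠ 0) (hl : ℓ = -l * ν) (hy : y ≠ 0)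
    (h : ℓ * x + ν = y) : y⁻¹ = l * (x / y) + ν⁻¹ := by
  rw [hl] at h
  field_simp
  linear_combination h

/-- In the coordinates `t = x / y` and `w = 1 / y`, the chord is the line `w = l t + ν⁻¹`. -/
theorem exists_line_of_one_lt_val [DecidableEq K] (hW : IsIntegralAt v W) {x₁ y₁ x₂ y₂ ℓ : K}
    (h₁ : W.toAffine.Equation x₁ y₁) (h₂ : W.toAffine.Equation x₂ y₂)
    (hxy : ¬ (x₁ = x₂ ∧ y₁ = W.toAffine.negY x₂ y₂)) (hx₁ : 1 < v x₁) (hx₂ : 1 < v x₂)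
    {τ : Γ₀} (hτ : τ < 1) (ht₁ : v (x₁ / y₁) ≤ τ) (ht₂ : v (x₂ / y₂) ≤ τ)
    (hℓ : W.toAffine.slope x₁ x₂ y₁ y₂ = ℓ) :
    ∃ l ν : K, ν ≠ 0 ∧ v l ≤ τ ^ 2 ∧ v ν⁻¹ ≤ τ ^ 2 ∧ ℓ = -l * ν ∧ y₁ - ℓ * x₁ = ν := by
  obtain ⟨l, hlτ, hl⟩ := exists_slope_eq_of_one_lt_val hW h₁ h₂ hxy hx₁ hx₂ hτ ht₁ ht₂
  rw [hℓ] at hl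
  obtain ⟨ν, hν⟩ : ∃ ν, y₁ - ℓ * x₁ = ν := ⟨_, rfl⟩
  rw [hν] at hl
  have hy₁0 := Y_ne_zero_of_one_lt_val hW h₁ hx₁
  have hν0 : ν ≠ 0 := by
    rintro rfl
    rw [mul_zero] at hl
    exact hy₁0 (by linear_combination hν + x₁ * hl)
  refine ⟨l, ν, hν0, hlτ, ?_, hl, hν⟩
  have hline := Y_inv_eq_of_line hν0 hl hy₁0 (x := x₁) (by rw [← hν]; ring)
  rw [show ν⁻¹ = y₁⁻¹ - x₁ / y₁ * l by rw [hline]; ring]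
  exact v.map_sub_le (val_Y_inv_le hW h₁ hx₁ ht₁) (val_mul_le (ht₁.trans hτ.le) hlτ)

theorem slope_vieta [DecidableEq K] {x₁ y₁ x₂ y₂ ℓ : K}
    (h₁ : W.toAffine.Equation x₁ y₁) (h₂ : W.toAffine.Equation x₂ y₂)
    (hxy : ¬ (x₁ = x₂ ∧ y₁ = W.toAffine.negY x₂ y₂)) (hℓ : W.toAffine.slope x₁ x₂ y₁ y₂ = ℓ) :
    x₁ + x₂ + W.toAffine.addX x₁ x₂ ℓ = ℓ ^ 2 + W.a₁ * ℓ - W.a₂ ∧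
    x₁ * x₂ + x₁ * W.toAffine.addX x₁ x₂ ℓ + x₂ * W.toAffine.addX x₁ x₂ ℓ =
      W.a₄ - 2 * ℓ * (y₁ - ℓ * x₁) - W.a₁ * (y₁ - ℓ * x₁) - W.a₃ * ℓ ∧
    x₁ * x₂ * W.toAffine.addX x₁ x₂ ℓ =
      (y₁ - ℓ * x₁) ^ 2 + W.a₃ * (y₁ - ℓ * x₁) - W.a₆ := by
  have h := addPolynomial_slope h₁ h₂ hxy
  rw [hℓ, addPolynomial_eq, neg_inj, Cubic.prod_X_sub_C_eq, Cubic.toPoly_injective,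
    Cubic.mk.injEq] at h
  obtain ⟨-, hb, hc, hd⟩ := h
  exact ⟨by linear_combination hb, by linear_combination -hc, by linear_combination hd⟩

theorem sum_X_div_Y_eq_of_line {a₁ a₂ a₃ a₄ a₆ x₁ x₂ x₃ y₁ y₂ y₃ ℓ ν l : K}
    (e₁ : x₁ + x₂ + x₃ = ℓ ^ 2 + a₁ * ℓ - a₂)
    (e₂ : x₁ * x₂ + x₁ * x₃ + x₂ * x₃ = a₄ - 2 * ℓ * ν - a₁ * ν - a₃ * ℓ)
    (e₃ : x₁ * x₂ * x₃ = ν ^ 2 + a₃ * ν - a₆) (hν : ν ≠ 0) (hl : ℓ = -l * ν)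
    (hB : 1 + (a₂ * l + a₄ * (l * l) + a₆ * (l * l * l)) ≠ 0)
    (hy₁ : ℓ * x₁ + ν = y₁) (hy₂ : ℓ * x₂ + ν = y₂) (hy₃ : ℓ * x₃ + ν = y₃) :
    y₃ ≠ 0 ∧ x₁ / y₁ + x₂ / y₂ + x₃ / y₃ =
      (a₁ * l + a₃ * (l * l) - a₂ * ν⁻¹ - 2 * a₄ * (l * ν⁻¹) - 3 * a₆ * (l * l * ν⁻¹)) /
        (1 + (a₂ * l + a₄ * (l * l) + a₆ * (l * l * l))) := by
  have hprod : y₁ * y₂ * y₃ = ν ^ 3 * (1 + (a₂ * l + a₄ * (l * l) + a₆ * (l * l * l))) := by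
    subst hl hy₁ hy₂ hy₃
    linear_combination (-l * ν) ^ 3 * e₃ + (-l * ν) ^ 2 * ν * e₂ + (-l * ν) * ν ^ 2 * e₁
  have hsum : x₁ * y₂ * y₃ + x₂ * y₁ * y₃ + x₃ * y₁ * y₂ =
      ν ^ 3 * (a₁ * l + a₃ * (l * l) - a₂ * ν⁻¹ - 2 * a₄ * (l * ν⁻¹) -
        3 * a₆ * (l * l * ν⁻¹)) := by
    subst hl hy₁ hy₂ hy₃
    field_simp
    linear_combination 3 * l ^ 2 * e₃ - 2 * l * e₂ + e₁
  have hne : y₁ * y₂ * y₃ ≠ 0 := hprod.trans_ne (mul_ne_zero (pow_ne_zero 3 hν) hB)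
  have hy₁₂ := left_ne_zero_of_mul hne
  have hy₁0 := left_ne_zero_of_mul hy₁₂
  have hy₂0 := right_ne_zero_of_mul hy₁₂
  have hy₃0 := right_ne_zero_of_mul hne
  refine ⟨hy₃0, ?_⟩
  rw [eq_div_iff hB]
  refine mul_right_cancel₀ (pow_ne_zero 3 hν) ?_
  rw [mul_assoc, mul_comm _ (ν ^ 3), mul_comm _ (ν ^ 3), ← hprod, ← hsum]
  field_simp

theorem val_sum_X_div_Y_le (hW : IsIntegralAt v W) {x₁ x₂ x₃ y₁ y₂ y₃ ℓ ν l : K} {c : Γ₀}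
    (hc : c < 1) (e₁ : x₁ + x₂ + x₃ = ℓ ^ 2 + W.a₁ * ℓ - W.a₂)
    (e₂ : x₁ * x₂ + x₁ * x₃ + x₂ * x₃ = W.a₄ - 2 * ℓ * ν - W.a₁ * ν - W.a₃ * ℓ)
    (e₃ : x₁ * x₂ * x₃ = ν ^ 2 + W.a₃ * ν - W.a₆) (hν : ν ≠ 0) (hl : ℓ = -l * ν)
    (hy₁ : ℓ * x₁ + ν = y₁) (hy₂ : ℓ * x₂ + ν = y₂) (hy₃ : ℓ * x₃ + ν = y₃)
    (hlc : v l ≤ c) (hνc : v ν⁻¹ ≤ c) :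
    y₃ ≠ 0 ∧ v (x₁ / y₁ + x₂ / y₂ + x₃ / y₃) ≤ c := by
  have hl1 : v l ≤ 1 := hlc.trans hc.le
  have hllc : v (l * l) ≤ c := val_mul_le hl1 hlc
  have hB : v (1 + (W.a₂ * l + W.a₄ * (l * l) + W.a₆ * (l * l * l))) = 1 :=
    v.map_one_add_of_lt <| lt_of_le_of_lt (v.map_add_le (v.map_add_le (val_mul_le hW.a₂ hlc)
      (val_mul_le hW.a₄ hllc)) (val_mul_le hW.a₆ (val_mul_le (hllc.trans hc.le) hlc))) hc
  obtain ⟨hy₃0, hsum⟩ :=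
    sum_X_div_Y_eq_of_line e₁ e₂ e₃ hν hl (ne_zero_of_val_eq_one hB) hy₁ hy₂ hy₃
  refine ⟨hy₃0, ?_⟩
  rw [hsum, map_div₀, hB, div_one]
  refine v.map_sub_le (v.map_sub_le (v.map_sub_le (v.map_add_le (val_mul_le hW.a₁ hlc)
    (val_mul_le hW.a₃ hllc)) (val_mul_le hW.a₂ hνc)) ?_) ?_
  · exact val_mul_le (val_mul_le (val_ofNat_le_one 2) hW.a₄) (val_mul_le hl1 hνc)
  · exact val_mul_le (val_mul_le (val_ofNat_le_one 3) hW.a₆)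
      (val_mul_le (hllc.trans hc.le) hνc)

theorem val_X_div_negY_le (hW : IsIntegralAt v W) {x y : K} (h : W.toAffine.Equation x y)
    (hx : 1 < v x) {τ : Γ₀} (hτ : τ < 1) (ht : v (x / y) ≤ τ) :
    v (x / W.toAffine.negY x y) ≤ τ ∧ v (x / W.toAffine.negY x y + x / y) ≤ τ ^ 2 := by
  have hy0 := Y_ne_zero_of_one_lt_val hW h hx
  have hw : v y⁻¹ ≤ τ :=
    (val_Y_inv_le hW h hx ht).trans (pow_le_of_le_one zero_le hτ.le two_ne_zero)
  obtain ⟨s, hs⟩ : ∃ s, s = W.a₁ * (x / y) + W.a₃ * y⁻¹ := ⟨_, rfl⟩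
  have hsτ : v s ≤ τ := hs ▸ v.map_add_le (val_mul_le hW.a₁ ht) (val_mul_le hW.a₃ hw)
  have hu : v (1 + s) = 1 := v.map_one_add_of_lt (hsτ.trans_lt hτ)
  have hu0 := ne_zero_of_val_eq_one hu
  have hneg : x / W.toAffine.negY x y = -(x / y / (1 + s)) := by
    rw [show W.toAffine.negY x y = -(y * (1 + s)) by rw [negY, hs]; field_simp; ring]
    field_simp
  have hadd : x / W.toAffine.negY x y + x / y = s * (x / y) / (1 + s) := by
    rw [hneg]
    field_simp
    ring
  constructor
  · rwa [hneg, v.map_neg, map_div₀, hu, div_one]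
  · rw [hadd, map_div₀, hu, div_one]
    exact val_mul_le_sq hsτ ht

theorem val_negAdd_of_one_lt_val [DecidableEq K] (hW : IsIntegralAt v W) {x₁ y₁ x₂ y₂ ℓ : K}
    (h₁ : W.toAffine.Nonsingular x₁ y₁) (h₂ : W.toAffine.Nonsingular x₂ y₂)
    (hxy : ¬ (x₁ = x₂ ∧ y₁ = W.toAffine.negY x₂ y₂)) (hx₁ : 1 < v x₁) (hx₂ : 1 < v x₂)
    {τ : Γ₀} (hτ : τ < 1) (ht₁ : v (x₁ / y₁) ≤ τ) (ht₂ : v (x₂ / y₂) ≤ τ)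
    (hℓ : W.toAffine.slope x₁ x₂ y₁ y₂ = ℓ) {x₃ y₃ : K} (hx₃ : W.toAffine.addX x₁ x₂ ℓ = x₃)
    (hy₃ : W.toAffine.negAddY x₁ x₂ y₁ ℓ = y₃) :
    1 < v x₃ ∧ v (x₃ / y₃) ≤ τ ∧ v (x₁ / y₁ + x₂ / y₂ + x₃ / y₃) ≤ τ ^ 2 := by
  have hτ2 : τ ^ 2 < 1 := pow_lt_one₀ zero_le hτ two_ne_zero
  have hττ : τ ^ 2 ≤ τ := pow_le_of_le_one zero_le hτ.le two_ne_zero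
  obtain ⟨l, ν, hν0, hlτ, hντ, hl, hν⟩ :=
    exists_line_of_one_lt_val hW h₁.1 h₂.1 hxy hx₁ hx₂ hτ ht₁ ht₂ hℓ
  have hslope := slope_mul_X_sub h₁.1 h₂.1 hxy
  have h₃ := (nonsingular_negAdd h₁ h₂ hxy).1
  obtain ⟨e₁, e₂, e₃⟩ := slope_vieta h₁.1 h₂.1 hxy hℓ
  rw [hℓ] at hslope h₃
  rw [hx₃] at e₁ e₂ e₃ h₃
  rw [hy₃] at h₃
  rw [hν] at e₂ e₃
  have hL₁ : ℓ * x₁ + ν = y₁ := by rw [← hν]; ring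
  have hL₂ : ℓ * x₂ + ν = y₂ := by rw [← hν]; linear_combination -hslope
  have hL₃ : ℓ * x₃ + ν = y₃ := by rw [← hν, ← hy₃, negAddY, hx₃]; ring
  obtain ⟨hy₃0, hsum⟩ := val_sum_X_div_Y_le hW hτ2 e₁ e₂ e₃ hν0 hl hL₁ hL₂ hL₃ hlτ hντ
  have ht₃ : v (x₃ / y₃) ≤ τ := by
    rw [show x₃ / y₃ = (x₁ / y₁ + x₂ / y₂ + x₃ / y₃) - x₁ / y₁ - x₂ / y₂ by ring]
    exact v.map_sub_le (v.map_sub_le (hsum.trans hττ) ht₁) ht₂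
  refine ⟨?_, ht₃, hsum⟩
  by_contra! hle
  have hw₃ : v y₃⁻¹ < 1 := by
    rw [Y_inv_eq_of_line hν0 hl hy₃0 hL₃, mul_comm l]
    exact (v.map_add_le (val_mul_le (ht₃.trans hτ.le) hlτ) hντ).trans_lt hτ2
  rw [map_inv₀] at hw₃
  exact hw₃.not_ge ((one_le_inv₀ (zero_lt_iff.2 (v.ne_zero_iff.2 hy₃0))).2
    (val_Y_le_one hW h₃ hle))

/-- The parameter `x / y` at the origin of a Weierstrass curve, with value `0` at the origin. -/
def originParam : W.toAffine.Point → K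
  | .zero => 0
  | .some x y _ => x / y

variable (v) in
/-- The points in the kernel of reduction whose parameter `x / y` has valuation at most `τ`. -/
def NearOrigin (τ : Γ₀) : W.toAffine.Point → Prop
  | .zero => True
  | .some x y _ => 1 < v x ∧ v (x / y) ≤ τ

/-- To first order, the group law near the origin is addition of the parameters. -/
theorem NearOrigin.add [DecidableEq K] (hW : IsIntegralAt v W) {τ : Γ₀} (hτ : τ < 1)
    {P Q : W.toAffine.Point} (hP : NearOrigin v τ P) (hQ : NearOrigin v τ Q) :
    NearOrigin v τ (P + Q) ∧ v (originParam (P + Q) - originParam P - originParam Q) ≤ τ ^ 2 := by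
  rcases P with (_ | ⟨x₁, y₁, h₁⟩)
  · rw [← Point.zero_def, zero_add]
    exact ⟨hQ, by simp [originParam]⟩
  rcases Q with (_ | ⟨x₂, y₂, h₂⟩)
  · rw [← Point.zero_def, add_zero]
    exact ⟨hP, by simp [originParam]⟩
  obtain ⟨hx₁, ht₁⟩ := hP
  obtain ⟨hx₂, ht₂⟩ := hQ
  by_cases hxy : x₁ = x₂ ∧ y₁ = W.toAffine.negY x₂ y₂
  · rw [Point.add_of_Y_eq hxy.1 hxy.2]
    obtain ⟨rfl, rfl⟩ := hxy
    refine ⟨trivial, ?_⟩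
    have hneg := (val_X_div_negY_le hW h₂.1 hx₂ hτ ht₂).2
    rwa [← v.map_neg, neg_add', ← zero_sub] at hneg
  rw [Point.add_some hxy]
  obtain ⟨hx₃, ht₃, hsum⟩ := val_negAdd_of_one_lt_val hW h₁ h₂ hxy hx₁ hx₂ hτ ht₁ ht₂ rfl rfl rfl
  have h₃ := (nonsingular_negAdd h₁ h₂ hxy).1
  obtain ⟨hneg, hneg_add⟩ := val_X_div_negY_le hW h₃ hx₃ hτ ht₃
  refine ⟨⟨hx₃, hneg⟩, ?_⟩
  have hsub := v.map_sub_le hneg_add hsum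
  rwa [add_sub_add_right_eq_sub, ← sub_sub] at hsub

theorem NearOrigin.nsmul [DecidableEq K] (hW : IsIntegralAt v W) {τ : Γ₀} (hτ : τ < 1)
    {P : W.toAffine.Point} (hP : NearOrigin v τ P) (n : ℕ) :
    NearOrigin v τ (n • P) ∧ v (originParam (n • P) - n * originParam P) ≤ τ ^ 2 := by
  induction n with
  | zero =>
    rw [zero_nsmul]
    exact ⟨trivial, by simp [originParam]⟩
  | succ n ih =>
    obtain ⟨hmem, hadd⟩ := ih.1.add hW hτ hP
    rw [succ_nsmul]
    refine ⟨hmem, ?_⟩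
    convert v.map_add_le hadd ih.2 using 2
    push_cast
    ring

/-- The kernel of reduction has no nonzero `N`-torsion: with `t` the parameter of a point, that of
its `N`-th multiple is `N t` up to terms of valuation at most `v t ^ 2 < v t`. -/
theorem nsmul_some_ne_zero_of_one_lt_val [DecidableEq K] (hW : IsIntegralAt v W) {N : ℕ}
    (hN : v (N : K) = 1) {x y : K} (h : W.toAffine.Nonsingular x y) (hx : 1 < v x) :
    N • (.some x y h : W.toAffine.Point) ≠ 0 := by
  intro h0
  have ht := val_X_div_Y_lt_one hW h.1 hx
  have hsq := (NearOrigin.nsmul hW ht (P := .some x y h) ⟨hx, le_rfl⟩ N).2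
  rw [h0] at hsq
  simp only [originParam, zero_sub, v.map_neg, map_mul, hN, one_mul] at hsq
  have hx0 : x ≠ 0 := by
    rintro rfl
    exact hx.not_ge ((map_zero v).trans_le zero_le)
  have hpos : 0 < v (x / y) :=
    zero_lt_iff.2 (v.ne_zero_iff.2 (div_ne_zero hx0 (Y_ne_zero_of_one_lt_val hW h.1 hx)))
  exact hsq.not_gt (pow_lt_self_of_lt_one₀ hpos ht one_lt_two)

theorem torsion_eq_of_val_sub_lt_one [DecidableEq K] (hW : IsIntegralAt v W) (hΔ : v W.Δ = 1)
    {N : ℕ} (hN : v (N : K) = 1) {x y x' y' : K} (hP : W.toAffine.Nonsingular x y)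
    (hP' : W.toAffine.Nonsingular x' y') (hNP : N • (.some x y hP : W.toAffine.Point) = 0)
    (hNP' : N • (.some x' y' hP' : W.toAffine.Point) = 0)
    (hxx : v x ≤ 1 → v (x - x') < 1) (hyy : v y ≤ 1 → v (y - y') < 1) :
    (.some x y hP : W.toAffine.Point) = .some x' y' hP' := by
  by_contra hne
  have hx : v x ≤ 1 := not_lt.1 fun h ↦ nsmul_some_ne_zero_of_one_lt_val hW hN hP h hNP
  have hx' : v x' ≤ 1 := not_lt.1 fun h ↦ nsmul_some_ne_zero_of_one_lt_val hW hN hP' h hNP'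
  obtain ⟨x₃, y₃, h₃, hx₃, hsub⟩ := exists_sub_eq_some_one_lt_val hW hΔ hP hP' hx hx' (hxx hx)
    (hyy (val_Y_le_one hW hP.1 hx)) hne
  refine nsmul_some_ne_zero_of_one_lt_val hW hN h₃ hx₃ ?_
  rw [← hsub, nsmul_sub, hNP, hNP', sub_zero]

end Reduction

section Inertia

theorem mem_range_restrictScalarsHom {F K L : Type*} [Field F] [Field K] [Field L] [Algebra F K]
    [Algebra F L] [Algebra K L] [IsScalarTower F K L] {σ : L ≃ₐ[F] L} :
    σ ∈ (AlgEquiv.restrictScalarsHom F : (L ≃ₐ[K] L) →* (L ≃ₐ[F] L)).range ↔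
      ∀ x : K, σ (algebraMap K L x) = algebraMap K L x := by
  refine ⟨?_, fun h ↦ ⟨AlgEquiv.ofRingEquiv (f := σ.toRingEquiv) h, rfl⟩⟩
  rintro ⟨τ, rfl⟩
  exact τ.commutes

theorem map_restrictScalarsHom_inertia (F K : Type*) {L : Type*} [Field F] [Field K] [Field L]
    [Algebra F K] [Algebra F L] [Algebra K L] [IsScalarTower F K L] (Q : Ideal (𝓞 L)) :
    (Q.inertia (L ≃ₐ[K] L)).map (AlgEquiv.restrictScalarsHom F) =
      (AlgEquiv.restrictScalarsHom F : (L ≃ₐ[K] L) →* (L ≃ₐ[F] L)).range ⊓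
        Q.inertia (L ≃ₐ[F] L) :=
  Subgroup.map_comap_eq (AlgEquiv.restrictScalarsHom F) (Q.inertia (L ≃ₐ[F] L))

variable {F K L : Type*} [Field F] [NumberField F] [Field K] [NumberField K] [Field L]
  [NumberField L] [Algebra F K] [Algebra F L] [Algebra K L] [IsScalarTower F K L] [IsGalois F L]

variable (F) in
theorem card_inertia_eq_ramificationIdx (Q : Ideal (𝓞 L)) [Q.IsPrime] :
    Nat.card (Q.inertia (L ≃ₐ[F] L)) = Q.ramificationIdx (𝓞 F) := by
  have hQ : Q.LiesOver (Q.under (𝓞 F)) := ⟨rfl⟩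
  rw [Ideal.card_inertia_eq_ramificationIdxIn (G := L ≃ₐ[F] L) (Q.under (𝓞 F)) Q,
    Ideal.ramificationIdxIn_eq_ramificationIdx (Q.under (𝓞 F)) Q (L ≃ₐ[F] L)]

theorem one_lt_ramificationIdx_under_iff (Q : Ideal (𝓞 L)) [Q.IsPrime] :
    1 < (Q.under (𝓞 K)).ramificationIdx (𝓞 F) ↔
      ∃ σ ∈ Q.inertia (L ≃ₐ[F] L), ∃ x : K, σ (algebraMap K L x) ≠ algebraMap K L x := by
  have : IsGalois K L := .tower_top_of_isGalois F K L
  have hQ : Q.LiesOver (Q.under (𝓞 K)) := ⟨rfl⟩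
  set I := Q.inertia (L ≃ₐ[F] L)
  set J := (Q.inertia (L ≃ₐ[K] L)).map (AlgEquiv.restrictScalarsHom F)
  have hJ : J = _ ⊓ I := map_restrictScalarsHom_inertia F K Q
  have hcard : Nat.card I = (Q.under (𝓞 K)).ramificationIdx (𝓞 F) * Nat.card J := by
    rw [card_inertia_eq_ramificationIdx, Ideal.ramificationIdx_tower (Q.under (𝓞 K)) Q,
      ← card_inertia_eq_ramificationIdx K Q,
      Subgroup.card_map_of_injective (AlgEquiv.restrictScalarsHom_injective F)]
  have hle : Nat.card I ≤ Nat.card J ↔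
      ∀ σ ∈ I, ∀ x : K, σ (algebraMap K L x) = algebraMap K L x := by
    simp_rw [← mem_range_restrictScalarsHom]
    refine ⟨fun h ↦ ?_, fun h ↦ ?_⟩
    · exact inf_eq_right.1 (hJ ▸ Subgroup.eq_of_le_of_card_ge (hJ ▸ inf_le_right) h)
    · rw [hJ, inf_eq_right.2 h]
  rw [← not_le, ← mul_le_iff_le_one_left (Nat.card_pos (α := J)), ← hcard, hle]
  push Not
  rfl

theorem ramifiesIn_iff_exists_inertia_apply_ne (v : HeightOneSpectrum (𝓞 F)) :
    RamifiesIn v K ↔ ∃ Q : Ideal (𝓞 L), Q.IsPrime ∧ Q.LiesOver v.asIdeal ∧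
      ∃ σ ∈ Q.inertia (L ≃ₐ[F] L), ∃ x : K, σ (algebraMap K L x) ≠ algebraMap K L x := by
  constructor
  · rintro ⟨P, hP, hPv, he⟩
    obtain ⟨⟨Q, hQ, hQP⟩⟩ := P.nonempty_primesOver (S := 𝓞 L)
    rw [hQP.over, one_lt_ramificationIdx_under_iff] at he
    exact ⟨Q, hQ, .trans Q P v.asIdeal, he⟩
  · rintro ⟨Q, hQ, hQv, he⟩
    rw [← one_lt_ramificationIdx_under_iff] at he
    exact ⟨Q.under (𝓞 K), inferInstance, inferInstance, he⟩

theorem ramifiesIn_iff_exists_mem_inertia_apply_ne {Ω : Type*} [Field Ω] [Algebra F Ω]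
    {K L : IntermediateField F Ω} [FiniteDimensional F L] [IsGalois F L] (hKL : K ≤ L)
    (v : HeightOneSpectrum (𝓞 F)) :
    RamifiesIn v K ↔ ∃ Q : Ideal (𝓞 L), Q.IsPrime ∧ Q.LiesOver v.asIdeal ∧
      ∃ σ ∈ Q.inertia (L ≃ₐ[F] L), ∃ x : L, (x : Ω) ∈ K ∧ σ x ≠ x := by
  let _ : Algebra K L := (inclusion hKL).toAlgebra
  have : IsScalarTower F K L := .of_algebraMap_eq' rfl
  have : NumberField L := .of_module_finite F L
  have : FiniteDimensional F K :=
    .of_injective (inclusion hKL).toLinearMap (inclusion_injective hKL)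
  have : NumberField K := .of_module_finite F K
  rw [ramifiesIn_iff_exists_inertia_apply_ne (L := L)]
  refine exists_congr fun Q ↦ and_congr_right fun _ ↦ and_congr_right fun _ ↦
    exists_congr fun σ ↦ and_congr_right fun _ ↦ ?_
  exact ⟨fun ⟨x, hx⟩ ↦ ⟨inclusion hKL x, x.2, hx⟩, fun ⟨x, hx, h⟩ ↦ ⟨⟨x, hx⟩, h⟩⟩

end Inertia

section Unramified

theorem apply_eq_self_of_mem_adjoin {F Ω : Type*} [Field F] [Field Ω] [Algebra F Ω]
    {L : IntermediateField F Ω} {S : Set Ω} (hSL : adjoin F S ≤ L) (σ : L →ₐ[F] L)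
    (hσ : ∀ z : L, (z : Ω) ∈ S → σ z = z) {x : L} (hx : (x : Ω) ∈ adjoin F S) : σ x = x := by
  have h : σ.comp (inclusion hSL) = inclusion hSL := adjoin_algHom_ext F fun z hz ↦ hσ _ hz
  exact DFunLike.congr_fun h ⟨x, hx⟩

theorem exists_isGalois_ge {F : Type*} [Field F] [PerfectField F]
    (K : IntermediateField F (AlgebraicClosure F)) [FiniteDimensional F K] :
    ∃ L : IntermediateField F (AlgebraicClosure F), K ≤ L ∧ FiniteDimensional F L ∧ IsGalois F L :=
  ⟨normalClosure F K (AlgebraicClosure F), K.le_normalClosure, inferInstance, inferInstance⟩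

theorem exists_eq_adjoin_simple {F Ω : Type*} [Field F] [Field Ω] [Algebra F Ω]
    (K : IntermediateField F Ω) [FiniteDimensional F K] [Algebra.IsSeparable F K] :
    ∃ θ, F⟮θ⟯ = K := by
  obtain ⟨θ, hθ⟩ := Field.exists_primitive_element F K
  exact ⟨θ, by rw [← lift_adjoin_simple, hθ, lift_top]⟩

theorem IsUnramifiedOutside.mono {F : Type*} [Field F] {𝔫 : Ideal (𝓞 F)}
    {L L' : IntermediateField F (AlgebraicClosure F)} (hLL' : L ≤ L')
    (h : IsUnramifiedOutside 𝔫 L') : IsUnramifiedOutside 𝔫 L :=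
  fun K hK ↦ h K (hK.trans hLL')

variable {F : Type*} [Field F] [NumberField F] {𝔫 : Ideal (𝓞 F)}

theorem isUnramifiedOutside_adjoin {S : Set (AlgebraicClosure F)}
    (hS : ∀ z ∈ S, IsUnramifiedOutside 𝔫 F⟮z⟯) : IsUnramifiedOutside 𝔫 (adjoin F S) := by
  intro K hK _ v hv
  obtain ⟨θ, rfl⟩ := exists_eq_adjoin_simple K
  obtain ⟨T, hTS, hθ⟩ := exists_finset_of_mem_adjoin (adjoin_simple_le_iff.1 hK)
  have : FiniteDimensional F (adjoin F (T : Set (AlgebraicClosure F))) :=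
    finiteDimensional_adjoin fun z _ ↦ Algebra.IsIntegral.isIntegral z
  obtain ⟨L, hTL, _, _⟩ := exists_isGalois_ge (adjoin F (T : Set (AlgebraicClosure F)))
  rw [← adjoin_simple_le_iff] at hθ
  obtain ⟨Q, hQ, hQv, σ, hσ, x, hx, hσx⟩ :=
    (ramifiesIn_iff_exists_mem_inertia_apply_ne (hθ.trans hTL) v).1 hv
  obtain ⟨z, hzT, hσz⟩ : ∃ z : L, (z : AlgebraicClosure F) ∈ T ∧ σ z ≠ z := by
    contrapose! hσx
    exact apply_eq_self_of_mem_adjoin hTL σ hσx (hθ hx)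
  refine hS z (hTS hzT) _ le_rfl (adjoin.finiteDimensional (Algebra.IsIntegral.isIntegral _)) v ?_
  rw [ramifiesIn_iff_exists_mem_inertia_apply_ne (adjoin_simple_le_iff.2 z.2)]
  exact ⟨Q, hQ, hQv, σ, hσ, z, mem_adjoin_simple_self F _, hσz⟩

theorem isUnramifiedOutside_sSup {𝓛 : Set (IntermediateField F (AlgebraicClosure F))}
    (h : ∀ L ∈ 𝓛, IsUnramifiedOutside 𝔫 L) : IsUnramifiedOutside 𝔫 (sSup 𝓛) := by
  rw [sSup_def]
  refine isUnramifiedOutside_adjoin ?_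
  rintro z ⟨_, ⟨L, hL, rfl⟩, hz⟩
  exact (h L hL).mono (adjoin_simple_le_iff.2 hz)

end Unramified

section ExponentTwo

variable {F : Type*} [Field F]

theorem isAbelianOfExponentTwo_iff [PerfectField F]
    {L : IntermediateField F (AlgebraicClosure F)} :
    IsAbelianOfExponentTwo L ↔
      Normal F L ∧ ∀ σ : AlgebraicClosure F ≃ₐ[F] AlgebraicClosure F, ∀ x ∈ L, σ (σ x) = x := by
  constructor
  · rintro ⟨_, -, hsq⟩
    refine ⟨inferInstance, fun σ x hx ↦ ?_⟩
    have h (y : L) : (σ.restrictNormal L y : AlgebraicClosure F) = σ y :=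
      σ.restrictNormal_commutes L y
    have := DFunLike.congr_fun (hsq (σ.restrictNormal L)) ⟨x, hx⟩
    rw [pow_two, AlgEquiv.mul_apply, Subtype.ext_iff, h, h] at this
    exact this
  · rintro ⟨_, hsq⟩
    have hsq' (σ : L ≃ₐ[F] L) : σ * σ = 1 := by
      ext x
      have h := hsq (σ.liftNormal _) x x.2
      rwa [← IntermediateField.algebraMap_apply, σ.liftNormal_commutes,
        σ.liftNormal_commutes] at h
    have hinv (σ : L ≃ₐ[F] L) : σ⁻¹ = σ := inv_eq_of_mul_eq_one_left (hsq' σ)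
    exact ⟨⟨⟩, fun σ τ ↦ by rw [← hinv (σ * τ), mul_inv_rev, hinv, hinv],
      fun σ ↦ (pow_two σ).trans (hsq' σ)⟩

theorem isAbelianOfExponentTwo_sSup [PerfectField F]
    {𝓛 : Set (IntermediateField F (AlgebraicClosure F))}
    (h : ∀ L ∈ 𝓛, IsAbelianOfExponentTwo L) : IsAbelianOfExponentTwo (sSup 𝓛) := by
  simp_rw [isAbelianOfExponentTwo_iff] at h ⊢
  have (L : 𝓛) : Normal F L.1 := (h L L.2).1
  refine ⟨sSup_eq_iSup' 𝓛 ▸ inferInstance, fun σ ↦ ?_⟩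
  have hle : sSup 𝓛 ≤ fixedField (Subgroup.zpowers (σ * σ)) :=
    sSup_le fun L hL ↦ (le_iff_le _ _).2 ((Subgroup.zpowers_le).2 fun x ↦ (h L hL).2 σ x x.2)
  exact fun x hx ↦ hle hx ⟨_, Subgroup.mem_zpowers _⟩

theorem isAbelianOfExponentTwo_adjoin_of_sq_eq [PerfectField F] {α : F}
    {β : AlgebraicClosure F} (hβ : β ^ 2 = algebraMap F (AlgebraicClosure F) α) :
    IsAbelianOfExponentTwo F⟮β⟯ := by
  refine isAbelianOfExponentTwo_iff.2 ⟨normal_iff_forall_map_le'.2 fun σ ↦ ?_, fun σ ↦ ?_⟩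
  · rw [adjoin_map, Set.image_singleton, adjoin_simple_le_iff]
    rcases apply_eq_or_eq_neg_of_sq_eq hβ σ with h | h
    · exact (congrArg (· ∈ F⟮β⟯) h).mpr (mem_adjoin_simple_self F β)
    · exact (congrArg (· ∈ F⟮β⟯) h).mpr (neg_mem (mem_adjoin_simple_self F β))
  · have hσσβ : σ (σ β) = β := by
      rcases apply_eq_or_eq_neg_of_sq_eq hβ σ with h | h <;> simp only [h, map_neg, neg_neg]
    have hσσ : (σ * σ : AlgebraicClosure F →ₐ[F] AlgebraicClosure F).comp F⟮β⟯.val =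
        F⟮β⟯.val := adjoin_algHom_ext F (by rintro _ rfl; exact hσσβ)
    exact fun x hx ↦ DFunLike.congr_fun hσσ ⟨x, hx⟩

theorem exists_isGreatest_isAbelianOfExponentTwo_isUnramifiedOutside [NumberField F]
    (𝔫 : Ideal (𝓞 F)) :
    ∃ M : IntermediateField F (AlgebraicClosure F),
      IsGreatest {L | IsAbelianOfExponentTwo L ∧ IsUnramifiedOutside 𝔫 L} M :=
  ⟨sSup _, ⟨isAbelianOfExponentTwo_sSup fun _ h ↦ h.1, isUnramifiedOutside_sSup fun _ h ↦ h.2⟩,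
    fun _ ↦ le_sSup⟩

end ExponentTwo

section Conductor

open WeierstrassCurve

variable {F : Type*} [Field F] [NumberField F]

theorem valuation_maximalIdeal_localRing_lt_one_iff (v : HeightOneSpectrum (𝓞 F)) {x : F}
    (hx : v.valuation F x ≤ 1) :
    (IsDiscreteValuationRing.maximalIdeal (localRing v)).valuation F x < 1 ↔
      v.valuation F x < 1 := by
  refine ((IsDiscreteValuationRing.maximalIdeal (localRing v)).valuation_lt_one_iff_mem
    (K := F) ⟨x, hx⟩).trans ?_
  change (⟨x, hx⟩ : localRing v) ∈ IsLocalRing.maximalIdeal (localRing v) ↔ _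
  rw [ValuationSubring.valuation_lt_one_iff]
  exact (v.valuation F).isEquiv_valuation_valuationSubring.lt_one_iff_lt_one.symm

theorem valuation_maximalIdeal_localRing_eq_one_iff (v : HeightOneSpectrum (𝓞 F)) {x : F}
    (hx : v.valuation F x ≤ 1) :
    (IsDiscreteValuationRing.maximalIdeal (localRing v)).valuation F x = 1 ↔
      v.valuation F x = 1 := by
  have hx' : (IsDiscreteValuationRing.maximalIdeal (localRing v)).valuation F x ≤ 1 :=
    HeightOneSpectrum.valuation_le_one (K := F) _ (⟨x, hx⟩ : localRing v)
  rw [← not_iff_not, ← ne_eq, ← ne_eq, ← hx'.lt_iff_ne, ← hx.lt_iff_ne,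
    valuation_maximalIdeal_localRing_lt_one_iff v hx]

theorem isIntegral_localRing_iff (v : HeightOneSpectrum (𝓞 F)) (W : WeierstrassCurve F) :
    IsIntegral (localRing v) W ↔ IsIntegralAt (v.valuation F) W := by
  constructor
  · intro
    obtain ⟨W₀, rfl⟩ := IsIntegral.integral (R := localRing v) (W := W)
    exact ⟨W₀.a₁.2, W₀.a₂.2, W₀.a₃.2, W₀.a₄.2, W₀.a₆.2⟩
  · intro h
    exact isIntegral_of_exists_lift _ ⟨⟨_, h.a₁⟩, rfl⟩ ⟨⟨_, h.a₂⟩, rfl⟩ ⟨⟨_, h.a₃⟩, rfl⟩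
      ⟨⟨_, h.a₄⟩, rfl⟩ ⟨⟨_, h.a₆⟩, rfl⟩

theorem valuation_Δ_le_one (v : HeightOneSpectrum (𝓞 F)) (W : WeierstrassCurve F)
    [IsIntegral (localRing v) W] : v.valuation F W.Δ ≤ 1 := by
  obtain ⟨r, hr⟩ := Δ_integral_of_isIntegral (localRing v) W
  rw [← hr]
  exact r.2

variable (E : WeierstrassCurve F)

theorem conductorExponent_eq_zero_iff (v : HeightOneSpectrum (𝓞 F)) :
    conductorExponent E v = 0 ↔ (E.minimal (localRing v)).HasGoodReduction (localRing v) := by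
  rw [conductorExponent]
  split_ifs with hgood hmult <;> simp [hgood]

theorem exists_smul_isIntegralAt_valuation_Δ_eq_one (v : HeightOneSpectrum (𝓞 F))
    (h : conductorExponent E v = 0) :
    ∃ C : VariableChange F, IsIntegralAt (v.valuation F) (C • E) ∧
      v.valuation F (C • E).Δ = 1 := by
  rw [conductorExponent_eq_zero_iff] at h
  refine ⟨(E.exists_isMinimal (localRing v)).choose, ?_, ?_⟩
  · exact (isIntegral_localRing_iff v (E.minimal (localRing v))).1 inferInstance
  · exact (valuation_maximalIdeal_localRing_eq_one_iff v
      (valuation_Δ_le_one v (E.minimal (localRing v)))).1 h.goodReduction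

theorem conductorExponent_eq_zero_of_isIntegralAt (v : HeightOneSpectrum (𝓞 F))
    (h : IsIntegralAt (v.valuation F) E) (hΔ : v.valuation F E.Δ = 1) :
    conductorExponent E v = 0 := by
  rw [conductorExponent_eq_zero_iff]
  have hE := (isIntegral_localRing_iff v E).2 h
  set W := E.minimal (localRing v)
  have hmin : IsMinimal (localRing v) W := inferInstance
  obtain ⟨C, hC⟩ : ∃ C : VariableChange F, C • W = E :=
    ⟨(E.exists_isMinimal (localRing v)).choose⁻¹, inv_smul_smul _ _⟩
  have hmax := hmin.val_Δ_maximal.2 (j := C) (show IsIntegral _ (C • W) from hC.symm ▸ hE)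
  simp only [one_smul, hC] at hmax
  have hΔE : (valuation_Δ_aux (localRing v) E : WithZero (Multiplicative ℤ)) = 1 := by
    rw [valuation_Δ_aux_eq_of_isIntegral]
    exact (valuation_maximalIdeal_localRing_eq_one_iff v hΔ.le).2 hΔ
  have hΔW := (valuation_Δ_aux (localRing v) W).2
  have hΔEW := hmax (Subtype.coe_le_coe.1 (hΔW.trans_eq hΔE.symm))
  rw [← Subtype.coe_le_coe, hΔE] at hΔEW
  refine { hmin with goodReduction := ?_ }
  rw [← valuation_Δ_aux_eq_of_isIntegral]
  exact le_antisymm hΔW hΔEW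

theorem finite_valuation_ne_one {x : F} (hx : x ≠ 0) :
    {v : HeightOneSpectrum (𝓞 F) | v.valuation F x ≠ 1}.Finite := by
  refine ((HeightOneSpectrum.Support.finite (𝓞 F) x).union
    (HeightOneSpectrum.Support.finite (𝓞 F) x⁻¹)).subset fun v hv ↦ ?_
  refine (lt_or_gt_of_ne hv).symm.imp id fun h ↦ ?_
  rw [HeightOneSpectrum.Support, Set.mem_ofPred_eq, map_inv₀]
  exact (one_lt_inv₀ (zero_lt_iff.2 ((Valuation.ne_zero_iff _).2 hx))).2 h

theorem conductor_ne_zero : conductor E ≠ 0 :=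
  finprod_induction (· ≠ 0) one_ne_zero (fun _ _ ↦ mul_ne_zero) fun v ↦ pow_ne_zero _ v.ne_bot

variable [E.IsElliptic]

theorem finite_conductorExponent_ne_zero :
    {v : HeightOneSpectrum (𝓞 F) | conductorExponent E v ≠ 0}.Finite := by
  have hint (a : F) := HeightOneSpectrum.Support.finite (𝓞 F) a
  refine ((hint E.a₁).union <| (hint E.a₂).union <| (hint E.a₃).union <| (hint E.a₄).union <|
    (hint E.a₆).union <| finite_valuation_ne_one E.isUnit_Δ.ne_zero).subset fun v hv ↦ ?_
  by_contra hgood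
  simp only [HeightOneSpectrum.Support, Set.mem_union, Set.mem_ofPred_eq, not_or, not_lt,
    not_not] at hgood
  obtain ⟨h₁, h₂, h₃, h₄, h₆, hΔ⟩ := hgood
  exact hv (conductorExponent_eq_zero_of_isIntegralAt E v ⟨h₁, h₂, h₃, h₄, h₆⟩ hΔ)

theorem hasFiniteMulSupport_conductor : Function.HasFiniteMulSupport
    fun v : HeightOneSpectrum (𝓞 F) ↦ v.asIdeal ^ conductorExponent E v :=
  (finite_conductorExponent_ne_zero E).subset fun v hv h0 ↦ hv (by simp [h0])

theorem dvd_conductor {v : HeightOneSpectrum (𝓞 F)} (h : conductorExponent E v ≠ 0) :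
    v.asIdeal ∣ conductor E :=
  (dvd_pow_self v.asIdeal h).trans (finprod_mem_dvd v (hasFiniteMulSupport_conductor E))

end Conductor

section Torsion

open WeierstrassCurve

variable {F : Type*} [Field F]

theorem valuation_sub_apply_lt_one_of_mem_inertia {L : Type*} [Field L] [NumberField L]
    [Algebra F L] (w : HeightOneSpectrum (𝓞 L)) {σ : L ≃ₐ[F] L}
    (hσ : σ ∈ w.asIdeal.inertia (L ≃ₐ[F] L)) {z : L} (hz : w.valuation L z ≤ 1) :
    w.valuation L (z - σ z) < 1 := by
  obtain ⟨a, b, hab⟩ := w.exists_primeCompl_mul_eq_of_integer z hz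
  have ha : σ • a - a ∈ w.asIdeal := hσ a
  have hb : σ • (b : 𝓞 L) - b ∈ w.asIdeal := hσ b
  have hσb : σ • (b : 𝓞 L) ∉ w.asIdeal := fun h ↦ b.2 ((w.asIdeal.sub_mem_iff_right h).1 hb)
  have hden : (b : 𝓞 L) * σ • (b : 𝓞 L) ∉ w.asIdeal := w.isPrime.mul_notMem b.2 hσb
  have hnum : a * (σ • (b : 𝓞 L) - b) - (σ • a - a) * b ∈ w.asIdeal :=
    sub_mem (w.asIdeal.mul_mem_left _ hb) (w.asIdeal.mul_mem_right _ ha)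
  have hσab : σ z * (σ • (b : 𝓞 L) : 𝓞 L) = (σ • a : 𝓞 L) := by
    change σ z * σ (b : 𝓞 L) = σ a
    rw [← map_mul]
    exact congrArg σ hab
  have hquot : (z - σ z) * algebraMap (𝓞 L) L (b * σ • (b : 𝓞 L)) =
      algebraMap (𝓞 L) L (a * (σ • (b : 𝓞 L) - b) - (σ • a - a) * b) := by
    simp only [map_mul, map_sub, ← hab]
    linear_combination (-algebraMap (𝓞 L) L b) * hσab
  have hval : w.valuation L ((z - σ z) * algebraMap (𝓞 L) L (b * σ • (b : 𝓞 L))) < 1 :=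
    hquot ▸ (w.valuation_lt_one_iff_mem _).2 hnum
  rwa [map_mul, (w.valuation_eq_one_iff_notMem (K := L)).2 hden, mul_one] at hval

theorem some_mem_torsion_iff (E : WeierstrassCurve F) {K L : Type*} [Field K] [Field L]
    [Algebra F K] [Algebra F L] {N : ℕ} (f : K →ₐ[F] L) {x y : K}
    (h : (E.baseChange K).toAffine.Nonsingular x y) :
    (.some (f x) (f y) ((E.toAffine.baseChange_nonsingular f.injective x y).2 h) : Points E L) ∈
      torsion E L N ↔ .some x y h ∈ torsion E K N := by
  classical
  let g : Points E K →+ Points E L := Affine.Point.map (W' := E) f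
  have hg : Function.Injective g := Affine.Point.map_injective f
  simp only [AddSubgroup.torsionBy.nsmul_iff]
  rw [← map_eq_zero_iff g hg, map_nsmul]
  rfl

variable [NumberField F]

theorem galPoint_eq_self_of_mem_inertia {L : Type*} [Field L] [NumberField L] [Algebra F L]
    {v : HeightOneSpectrum (𝓞 F)} (w : HeightOneSpectrum (𝓞 L)) [w.asIdeal.LiesOver v.asIdeal]
    {W : WeierstrassCurve F} (hW : IsIntegralAt (v.valuation F) W) (hΔ : v.valuation F W.Δ = 1)
    {N : ℕ} (hN : v.valuation F (N : F) = 1) {σ : L ≃ₐ[F] L}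
    (hσ : σ ∈ w.asIdeal.inertia (L ≃ₐ[F] L)) {P : Points W L} (hP : P ∈ torsion W L N) :
    galPoint W L σ P = P := by
  classical
  have hle {a : F} (ha : v.valuation F a ≤ 1) : w.valuation L (algebraMap F L a) ≤ 1 := by
    rw [← HeightOneSpectrum.valuation_liesOver L v w]
    exact pow_le_one' ha _
  have hone {a : F} (ha : v.valuation F a = 1) : w.valuation L (algebraMap F L a) = 1 := by
    rw [← HeightOneSpectrum.valuation_liesOver L v w, ha, one_pow]
  have hWL : IsIntegralAt (w.valuation L) (W.baseChange L) :=
    ⟨hle hW.a₁, hle hW.a₂, hle hW.a₃, hle hW.a₄, hle hW.a₆⟩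
  have hΔL : w.valuation L (W.baseChange L).Δ = 1 := by
    rw [WeierstrassCurve.baseChange, WeierstrassCurve.map_Δ]
    exact hone hΔ
  have hNL : w.valuation L (N : L) = 1 := by
    rw [← map_natCast (algebraMap F L)]
    exact hone hN
  obtain _ | ⟨x, y, h⟩ := P
  · rfl
  have hσP := galPoint_mem W L N σ hP
  rw [AddSubgroup.torsionBy.nsmul_iff] at hP hσP
  refine (torsion_eq_of_val_sub_lt_one hWL hΔL hNL h _ ?_ ?_
    (valuation_sub_apply_lt_one_of_mem_inertia w hσ)
    (valuation_sub_apply_lt_one_of_mem_inertia w hσ)).symm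
  · convert hP
  · convert hσP
    rfl

variable (E : WeierstrassCurve F) [E.IsElliptic]

theorem galPoint_eq_self_of_mem_inertia_of_not_dvd {L : Type*} [Field L] [NumberField L]
    [Algebra F L] {N : ℕ} {v : HeightOneSpectrum (𝓞 F)}
    (hv : ¬ v.asIdeal ∣ Ideal.span {(N : 𝓞 F)} * conductor E) {Q : Ideal (𝓞 L)} (hQ : Q.IsPrime)
    (hQv : Q.LiesOver v.asIdeal) {σ : L ≃ₐ[F] L} (hσ : σ ∈ Q.inertia (L ≃ₐ[F] L))
    {P : Points E L} (hP : P ∈ torsion E L N) : galPoint E L σ P = P := by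
  obtain ⟨C, hC, hΔ⟩ := exists_smul_isIntegralAt_valuation_Δ_eq_one E v
    (not_not.1 fun h ↦ hv ((dvd_conductor E h).mul_left _))
  have hN : v.valuation F (N : F) = 1 := by
    rw [← map_natCast (algebraMap (𝓞 F) F), HeightOneSpectrum.valuation_eq_one_iff_notMem]
    exact fun h ↦ hv ((Ideal.dvd_span_singleton.2 h).mul_right _)
  let w : HeightOneSpectrum (𝓞 L) := ⟨Q, hQ, Ideal.ne_bot_of_liesOver_of_ne_bot v.ne_bot Q⟩
  have : w.asIdeal.LiesOver v.asIdeal := hQv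
  exact galPoint_eq_self_of_smul E
    (fun _ h ↦ galPoint_eq_self_of_mem_inertia w hC hΔ hN hσ h) hP

theorem isUnramifiedOutside_divisionField (N : ℕ) :
    IsUnramifiedOutside (Ideal.span {(N : 𝓞 F)} * conductor E) (divisionField E N) := by
  refine isUnramifiedOutside_adjoin ?_
  rintro z ⟨x, y, h, hP, hz⟩ K hK _ v hv
  by_contra hvN
  set S : Set (AlgebraicClosure F) := {x, y}
  have hzS : F⟮z⟯ ≤ adjoin F S := adjoin.mono F _ _ (Set.singleton_subset_iff.2 hz)
  have : FiniteDimensional F (adjoin F S) :=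
    finiteDimensional_adjoin fun a _ ↦ Algebra.IsIntegral.isIntegral a
  obtain ⟨L, hSL, _, _⟩ := exists_isGalois_ge (adjoin F S)
  have : NumberField L := .of_module_finite F L
  obtain ⟨Q, hQ, hQv, σ, hσ, a, ha, hσa⟩ :=
    (ramifiesIn_iff_exists_mem_inertia_apply_ne ((hK.trans hzS).trans hSL) v).1 hv
  obtain ⟨x, rfl⟩ : ∃ x' : L, (x' : AlgebraicClosure F) = x :=
    ⟨⟨x, hSL (subset_adjoin F S (Or.inl rfl))⟩, rfl⟩
  obtain ⟨y, rfl⟩ : ∃ y' : L, (y' : AlgebraicClosure F) = y :=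
    ⟨⟨y, hSL (subset_adjoin F S (Or.inr rfl))⟩, rfl⟩
  have hxy : (E.baseChange L).toAffine.Nonsingular x y :=
    (E.toAffine.baseChange_nonsingular (f := L.val) L.val.injective x y).1 h
  have hσP := galPoint_eq_self_of_mem_inertia_of_not_dvd E hvN hQ hQv hσ
    ((some_mem_torsion_iff E L.val hxy).1 hP)
  obtain ⟨hσx, hσy⟩ := Affine.Point.some.inj hσP
  refine hσa (apply_eq_self_of_mem_adjoin hSL σ.toAlgHom ?_ (hzS (hK ha)))
  rintro b (hb | hb)
  · rwa [← Subtype.ext hb] at hσx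
  · rwa [← Subtype.ext hb] at hσy

end Torsion

section Selmer

open WithZero nonZeroDivisors

variable {R K : Type*} [CommRing R] [IsDedekindDomain R] [Field K] [Algebra R K]
  [IsFractionRing R K] {S : Set (HeightOneSpectrum R)} {n : ℕ}

theorem toAdd_valuationOfNeZero (v : HeightOneSpectrum R) (x : Kˣ) :
    (v.valuationOfNeZero x).toAdd =
      -FractionalIdeal.count K v (FractionalIdeal.spanSingleton R⁰ (x : K)) := by
  classical
  obtain ⟨a, d, hd, hx⟩ := IsFractionRing.div_surjective (A := R) (x : K)
  have hd0 : d ≠ 0 := nonZeroDivisors.ne_zero hd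
  have ha0 : a ≠ 0 := fun ha ↦ x.ne_zero (by rw [← hx, ha, map_zero, zero_div])
  have hval : v.valuation K (x : K) =
      exp (-FractionalIdeal.count K v (FractionalIdeal.spanSingleton R⁰ (x : K))) := by
    rw [FractionalIdeal.count_well_defined K v (a := d) (J := Ideal.span {a})
      (FractionalIdeal.spanSingleton_ne_zero_iff.2 x.ne_zero), ← hx, map_div₀,
      HeightOneSpectrum.valuation_of_algebraMap, HeightOneSpectrum.valuation_of_algebraMap,
      HeightOneSpectrum.intValuation_if_neg v ha0, HeightOneSpectrum.intValuation_if_neg v hd0,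
      ← exp_sub, neg_sub_neg, neg_sub]
    rw [FractionalIdeal.coeIdeal_span_singleton, FractionalIdeal.spanSingleton_mul_spanSingleton,
      ← hx, div_eq_inv_mul]
  rw [← HeightOneSpectrum.valuationOfNeZero_eq] at hval
  exact congrArg Multiplicative.toAdd (WithZero.coe_injective hval)

theorem valuationOfNeZeroMod_mk (v : HeightOneSpectrum R) (x : Kˣ) :
    v.valuationOfNeZeroMod n (QuotientGroup.mk x) =
      Multiplicative.ofAdd ((v.valuationOfNeZero x).toAdd : ZMod n) :=
  rfl

theorem valuationOfNeZeroMod_mk_eq_one_iff (v : HeightOneSpectrum R) (x : Kˣ) :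
    v.valuationOfNeZeroMod n (QuotientGroup.mk x) = 1 ↔
      (n : ℤ) ∣ (v.valuationOfNeZero x).toAdd := by
  rw [valuationOfNeZeroMod_mk, ofAdd_eq_one, ZMod.intCast_zmod_eq_zero_iff_dvd]

theorem exists_pow_eq_toPrincipalIdeal {x : Kˣ}
    (hx : QuotientGroup.mk x ∈ selmerGroup (R := R) (K := K) (S := ∅) (n := n)) :
    ∃ J : (FractionalIdeal R⁰ K)ˣ, J ^ n = toPrincipalIdeal R K x := by
  set I := toPrincipalIdeal R K x
  have hdvd (v : HeightOneSpectrum R) : (n : ℤ) ∣ FractionalIdeal.count K v I := by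
    have := (valuationOfNeZeroMod_mk_eq_one_iff v x).1 (hx v (Set.notMem_empty v))
    rwa [toAdd_valuationOfNeZero, dvd_neg, ← coe_toPrincipalIdeal] at this
  let m (v : HeightOneSpectrum R) : ℤ := FractionalIdeal.count K v I / n
  have hfin : Function.HasFiniteMulSupport fun v : HeightOneSpectrum R ↦
      (v.asIdeal : FractionalIdeal R⁰ K) ^ m v := by
    refine (Filter.eventually_cofinite.1 (FractionalIdeal.finite_factors
      (I : FractionalIdeal R⁰ K))).subset fun v hv h0 ↦ hv ?_
    simp only [m, h0, Int.zero_ediv, zpow_zero]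
  have hJ : (∏ᶠ v : HeightOneSpectrum R, (v.asIdeal : FractionalIdeal R⁰ K) ^ m v) ^ n = I := by
    rw [finprod_pow hfin, ← FractionalIdeal.finprod_heightOneSpectrum_factorization' K I.ne_zero]
    refine finprod_congr fun v ↦ ?_
    rw [← zpow_natCast, ← zpow_mul, Int.ediv_mul_cancel (hdvd v)]
  have hJ0 : ∏ᶠ v : HeightOneSpectrum R, (v.asIdeal : FractionalIdeal R⁰ K) ^ m v ≠ 0 :=
    finprod_induction (· ≠ 0) one_ne_zero (fun _ _ ↦ mul_ne_zero) fun v ↦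
      zpow_ne_zero _ (FractionalIdeal.coeIdeal_ne_zero.2 v.ne_bot)
  exact ⟨Units.mk0 _ hJ0, Units.ext hJ⟩

theorem exists_unit_mul_pow_eq {x : Kˣ} {J : (FractionalIdeal R⁰ K)ˣ}
    (hJ : J ^ n = toPrincipalIdeal R K x) (hJ1 : ClassGroup.mk K J = 1) :
    ∃ (w : Rˣ) (c : Kˣ), Units.map (algebraMap R K).toMonoidHom w * c ^ n = x := by
  obtain ⟨c, rfl⟩ : ∃ c, toPrincipalIdeal R K c = J := by
    rw [ClassGroup.mk_eq_one_iff] at hJ1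
    exact mem_principal_ideals_iff.2 ⟨_, (FractionalIdeal.eq_spanSingleton_of_principal _).symm⟩
  rw [← map_pow, Units.ext_iff, coe_toPrincipalIdeal, coe_toPrincipalIdeal] at hJ
  have : Module.IsTorsionFree R K := Module.isTorsionFree_iff_faithfulSMul.2 inferInstance
  obtain ⟨w, hw⟩ := FractionalIdeal.spanSingleton_eq_spanSingleton.1 hJ
  refine ⟨w, c, Units.ext ?_⟩
  rw [← hw, Units.smul_def, Algebra.smul_def]
  rfl

theorem finite_of_div_mem {G ι : Type*} [Group G] [Finite ι] (H : Subgroup G) [Finite H]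
    (f : G → ι) (hf : ∀ x y, f x = f y → x / y ∈ H) : Finite G := by
  refine Set.finite_univ_iff.1 (Set.Finite.of_finite_fibers f (Set.toFinite _) fun i hi ↦ ?_)
  obtain ⟨y, -, rfl⟩ := hi
  refine ((H : Set G).toFinite.image (· * y)).subset fun x hx ↦ ?_
  exact ⟨x / y, hf x y hx.2, div_mul_cancel x y⟩

theorem selmerGroup_pow_eq_one (x : selmerGroup (R := R) (K := K) (S := S) (n := n)) :
    x ^ n = 1 := by
  obtain ⟨⟨x⟩, hx⟩ := x
  exact Subtype.ext ((QuotientGroup.eq_one_iff _).2 ⟨x, rfl⟩)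

theorem finite_range_fromUnit [Group.FG Rˣ] [NeZero n] :
    Finite (selmerGroup.fromUnit (R := R) (K := K) (n := n)).range := by
  have : Group.FG (selmerGroup.fromUnit (R := R) (K := K) (n := n)).range := Group.fg_range _
  refine CommGroup.finite_of_fg_isMulTorsion _ fun x ↦ isOfFinOrder_iff_pow_eq_one.2
    ⟨n, NeZero.pos n, Subtype.ext (selmerGroup_pow_eq_one x.1)⟩

theorem mk_mem_range_fromUnit {w : Rˣ} {c x : Kˣ}
    (hwc : Units.map (algebraMap R K).toMonoidHom w * c ^ n = x)
    (hx : QuotientGroup.mk x ∈ selmerGroup (R := R) (K := K) (S := ∅) (n := n)) :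
    (⟨QuotientGroup.mk x, hx⟩ : selmerGroup (R := R) (K := K) (S := ∅) (n := n)) ∈
      (selmerGroup.fromUnit (R := R) (K := K) (n := n)).range :=
  ⟨w, Subtype.ext (QuotientGroup.eq.2 ⟨c, by rw [← hwc, inv_mul_cancel_left]; rfl⟩)⟩

theorem finite_selmerGroup_empty [Finite (ClassGroup R)] [Group.FG Rˣ] [NeZero n] :
    Finite (selmerGroup (R := R) (K := K) (S := ∅) (n := n)) := by
  have hJ (x : selmerGroup (R := R) (K := K) (S := ∅) (n := n)) :
      ∃ (y : Kˣ) (J : (FractionalIdeal R⁰ K)ˣ), QuotientGroup.mk y = x.1 ∧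
        J ^ n = toPrincipalIdeal R K y := by
    obtain ⟨⟨y⟩, hy⟩ := x
    exact ⟨y, (exists_pow_eq_toPrincipalIdeal hy).imp fun J hJ ↦ ⟨rfl, hJ⟩⟩
  choose y J hy hJ using hJ
  have := finite_range_fromUnit (R := R) (K := K) (n := n)
  refine finite_of_div_mem selmerGroup.fromUnit.range (fun x ↦ ClassGroup.mk K (J x))
    fun x x' hxx' ↦ ?_
  obtain ⟨w, c, hwc⟩ := exists_unit_mul_pow_eq (x := y x / y x') (J := J x / J x')
    (by rw [div_pow, hJ, hJ, map_div]) (by rw [map_div, hxx', div_self'])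
  have hmk : QuotientGroup.mk (y x / y x') = (x / x').1 := by
    rw [QuotientGroup.mk_div, hy, hy, Subgroup.coe_div]
  convert mk_mem_range_fromUnit hwc (hmk ▸ (x / x').2)
  exact hmk.symm

theorem finite_selmerGroup [Finite (ClassGroup R)] [Group.FG Rˣ] [NeZero n] (hS : S.Finite) :
    Finite (selmerGroup (R := R) (K := K) (S := S) (n := n)) := by
  have := hS.to_subtype
  have := finite_selmerGroup_empty (R := R) (K := K) (n := n)
  set val := selmerGroup.valuation (R := R) (K := K) (S := S) (n := n) with hval
  have : Finite val.ker := by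
    rw [hval, selmerGroup.valuation_ker_eq]
    exact Finite.of_injective (fun z ↦ (⟨z.1.1, z.2⟩ : selmerGroup (S := ∅)))
      fun _ _ h ↦ Subtype.ext (Subtype.ext (Subtype.mk.inj h))
  exact finite_of_div_mem val.ker val fun x y hxy ↦ by
    rw [MonoidHom.mem_ker, map_div, hxy, div_self']

theorem valuationOfNeZeroMod_mk_generator {v : HeightOneSpectrum R} {π : R} {x : Kˣ}
    (hx : (x : K) = algebraMap R K π) (hπ : v.asIdeal = Ideal.span {π}) :
    v.valuationOfNeZeroMod n (QuotientGroup.mk x) = Multiplicative.ofAdd (-1) := by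
  have hπ0 : π ≠ 0 := fun h ↦ x.ne_zero (by rw [hx, h, map_zero])
  have hval := v.valuationOfNeZero_eq x
  rw [hx, HeightOneSpectrum.valuation_of_algebraMap,
    HeightOneSpectrum.intValuation_singleton _ hπ0 hπ] at hval
  rw [valuationOfNeZeroMod_mk, WithZero.coe_injective hval, toAdd_ofAdd, Int.cast_neg,
    Int.cast_one]

theorem valuationOfNeZeroMod_mk_generator_of_ne {v w : HeightOneSpectrum R} {π : R} {x : Kˣ}
    (hx : (x : K) = algebraMap R K π) (hπ : w.asIdeal = Ideal.span {π}) (hvw : v ≠ w) :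
    v.valuationOfNeZeroMod n (QuotientGroup.mk x) = 1 := by
  have hπv : π ∉ v.asIdeal := fun hmem ↦ hvw <| HeightOneSpectrum.ext
    (w.isMaximal.eq_of_le v.isPrime.ne_top (by rwa [hπ, Ideal.span_singleton_le_iff_mem])).symm
  have hval := v.valuationOfNeZero_eq x
  rw [hx, (v.valuation_eq_one_iff_notMem).2 hπv, ← WithZero.coe_one] at hval
  rw [valuationOfNeZeroMod_mk, WithZero.coe_injective hval, toAdd_one, Int.cast_zero, ofAdd_zero]

theorem exists_mk_div_prod_pow_mem_selmerGroup_empty [NeZero n] {ι : Type*} [Fintype ι]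
    {p : ι → HeightOneSpectrum R} (hp : Function.Injective p) {π : ι → R} {ϖ : ι → Kˣ}
    (hϖ : ∀ i, (ϖ i : K) = algebraMap R K (π i)) (hπ : ∀ i, (p i).asIdeal = Ideal.span {π i})
    {x : Kˣ}
    (hx : QuotientGroup.mk x ∈ selmerGroup (R := R) (K := K) (S := Set.range p) (n := n)) :
    ∃ k : ι → Fin n, QuotientGroup.mk (x / ∏ i, ϖ i ^ (k i : ℕ)) ∈
      selmerGroup (R := R) (K := K) (S := ∅) (n := n) := by
  let z (i : ι) : ZMod n := ((p i).valuationOfNeZeroMod n (QuotientGroup.mk x)).toAdd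
  refine ⟨fun i ↦ ⟨(-z i).val, (-z i).val_lt⟩, fun v _ ↦ ?_⟩
  rw [QuotientGroup.mk_div, map_div, div_eq_one, ← QuotientGroup.mk'_apply _ (∏ i, _), map_prod,
    map_prod]
  simp only [map_pow, QuotientGroup.mk'_apply]
  by_cases hv : v ∈ Set.range p
  · obtain ⟨i, rfl⟩ := hv
    rw [Finset.prod_eq_single_of_mem i (Finset.mem_univ i) fun j _ hji ↦ by
      rw [valuationOfNeZeroMod_mk_generator_of_ne (hϖ j) (hπ j) (hp.ne hji.symm), one_pow],
      valuationOfNeZeroMod_mk_generator (hϖ i) (hπ i), ← ofAdd_nsmul, smul_neg, nsmul_one,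
      ZMod.natCast_zmod_val, neg_neg, ofAdd_toAdd]
  · rw [hx v hv, Finset.prod_eq_one fun j _ ↦ by
      rw [valuationOfNeZeroMod_mk_generator_of_ne (hϖ j) (hπ j) fun h ↦ hv ⟨j, h.symm⟩, one_pow]]

theorem exists_eq_unit_mul_prod_pow_mul_pow [Subsingleton (ClassGroup R)] [NeZero n]
    {ι : Type*} [Fintype ι] {p : ι → HeightOneSpectrum R} (hp : Function.Injective p)
    {π : ι → R} (hπ : ∀ i, (p i).asIdeal = Ideal.span {π i}) {x : Kˣ}
    (hx : QuotientGroup.mk x ∈ selmerGroup (R := R) (K := K) (S := Set.range p) (n := n)) :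
    ∃ (w : Rˣ) (k : ι → Fin n) (c : Kˣ),
      (x : K) = algebraMap R K (w * ∏ i, π i ^ (k i : ℕ)) * (c : K) ^ n := by
  have hπ0 (i : ι) : algebraMap R K (π i) ≠ 0 := fun h ↦ (p i).ne_bot <| by
    rw [hπ, (map_eq_zero_iff _ (IsFractionRing.injective R K)).1 h, Ideal.span_singleton_zero]
  obtain ⟨k, hk⟩ := exists_mk_div_prod_pow_mem_selmerGroup_empty hp
    (ϖ := fun i ↦ Units.mk0 _ (hπ0 i)) (fun _ ↦ Units.val_mk0 _) hπ hx
  obtain ⟨J, hJ⟩ := exists_pow_eq_toPrincipalIdeal hk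
  obtain ⟨w, c, hwc⟩ := exists_unit_mul_pow_eq hJ (Subsingleton.elim _ _)
  refine ⟨w, k, c, ?_⟩
  rw [eq_div_iff_mul_eq', Units.ext_iff] at hwc
  rw [← hwc]
  simp [mul_right_comm]

end Selmer

theorem mk_mem_selmerGroup_of_pow_eq {F Ω : Type*} [Field F] [NumberField F] [Field Ω]
    [Algebra F Ω] [Algebra.IsIntegral F Ω] {n : ℕ} [NeZero n]
    {S : Set (HeightOneSpectrum (𝓞 F))} {α : Fˣ} {β : Ω} (hβ : β ^ n = algebraMap F Ω α)
    (hS : ∀ v, RamifiesIn v F⟮β⟯ → v ∈ S) :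
    QuotientGroup.mk α ∈ selmerGroup (R := 𝓞 F) (K := F) (S := S) (n := n) := by
  intro v hv
  have : FiniteDimensional F F⟮β⟯ := adjoin.finiteDimensional (Algebra.IsIntegral.isIntegral β)
  have : NumberField F⟮β⟯ := NumberField.of_module_finite F F⟮β⟯
  obtain ⟨⟨P, hP, hPv⟩⟩ := v.asIdeal.nonempty_primesOver (S := 𝓞 F⟮β⟯)
  let w : HeightOneSpectrum (𝓞 F⟮β⟯) := ⟨P, hP, Ideal.ne_bot_of_liesOver_of_ne_bot v.ne_bot P⟩
  have : w.asIdeal.LiesOver v.asIdeal := hPv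
  have hram : v.asIdeal.ramificationIdx' P = 1 := by
    refine le_antisymm ?_ (Nat.one_le_iff_ne_zero.2
      (Ideal.IsDedekindDomain.ramificationIdx'_ne_zero_of_liesOver P v.ne_bot))
    rw [Ideal.ramificationIdx'_eq_ramificationIdx v.asIdeal P v.ne_bot]
    exact not_lt.1 fun h ↦ hv (hS v ⟨P, hP, hPv, h⟩)
  have hgen : algebraMap F F⟮β⟯ α = AdjoinSimple.gen F β ^ n := Subtype.ext hβ.symm
  have hγ0 : AdjoinSimple.gen F β ≠ 0 := fun h ↦ α.ne_zero <| by
    rwa [h, zero_pow (NeZero.ne n), map_eq_zero] at hgen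
  have hval := HeightOneSpectrum.valuation_liesOver F⟮β⟯ v w (α : F)
  rw [hram, pow_one, hgen, map_pow, ← Units.val_mk0 hγ0, ← v.valuationOfNeZero_eq,
    ← w.valuationOfNeZero_eq, ← WithZero.coe_pow, WithZero.coe_inj] at hval
  rw [valuationOfNeZeroMod_mk_eq_one_iff, hval, toAdd_pow]
  exact ⟨_, nsmul_eq_mul _ _⟩

theorem zpow_eq_pow_fin_two_mul_sq {G : Type*} [Group G] (g : G) (m : ℤ) :
    ∃ (k : Fin 2) (c : G), g ^ m = g ^ (k : ℕ) * c ^ 2 := by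
  refine ⟨⟨(m % 2).toNat, by omega⟩, g ^ (m / 2), ?_⟩
  rw [← zpow_natCast g, ← zpow_natCast (g ^ (m / 2)), ← zpow_mul, ← zpow_add]
  congr 1
  push_cast
  omega

theorem exists_eq_mul_pow_fin_two_mul_sq {R : Type*} [CommRing R] {u : Rˣ}
    (hu : Subgroup.closure {-1, u} = ⊤) (w : Rˣ) :
    ∃ (ε : Rˣ) (k : Fin 2) (d : Rˣ), (ε = 1 ∨ ε = -1) ∧ w = ε * u ^ (k : ℕ) * d ^ 2 := by
  obtain ⟨l, m, rfl⟩ := Subgroup.mem_closure_pair.1 (hu ▸ Subgroup.mem_top w)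
  obtain ⟨k, d, hd⟩ := zpow_eq_pow_fin_two_mul_sq u m
  exact ⟨(-1) ^ l, k, d, l.even_or_odd.imp Even.neg_one_zpow Odd.neg_one_zpow,
    by rw [hd, mul_assoc]⟩

theorem exists_mem_twistSet {F : Type*} [Field F] [NumberField F]
    (hclass : NumberField.classNumber F = 1) {n : ℕ} {p : Fin n → HeightOneSpectrum (𝓞 F)}
    (hp : Function.Injective p) {π : Fin n → 𝓞 F}
    (hπ : ∀ i, (p i).asIdeal = Ideal.span {π i}) {u : (𝓞 F)ˣ}
    (hu : Subgroup.closure {-1, u} = ⊤) {α : Fˣ}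
    (hα : QuotientGroup.mk α ∈
      selmerGroup (R := 𝓞 F) (K := F) (S := Set.range p) (n := 2)) :
    ∃ a ∈ twistSet u π, ∃ c : Fˣ, (α : F) = algebraMap (𝓞 F) F a * (c : F) ^ 2 := by
  have : Subsingleton (ClassGroup (𝓞 F)) := Fintype.card_le_one_iff_subsingleton.1 hclass.le
  obtain ⟨w, k, c, hαc⟩ := exists_eq_unit_mul_prod_pow_mul_pow hp hπ hα
  obtain ⟨ε, k₀, d, hε, rfl⟩ := exists_eq_mul_pow_fin_two_mul_sq hu w
  refine ⟨ε * (u : 𝓞 F) ^ (k₀ : ℕ) * ∏ i, π i ^ (k i : ℕ),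
    ⟨ε, k₀, k, hε.imp (congrArg Units.val) (congrArg Units.val), rfl⟩,
    Units.map (algebraMap (𝓞 F) F) d * c, ?_⟩
  rw [hαc]
  simp only [Units.val_mul, Units.val_pow_eq_pow_val, map_mul, map_pow, Units.coe_map,
    MonoidHom.coe_coe]
  ring

theorem dvd_span_natCast_mul_absNorm {R : Type*} [CommRing R] [IsDedekindDomain R]
    [Module.Free ℤ R] {N : ℕ} {𝔞 𝔮 : Ideal R} (h : 𝔮 ∣ Ideal.span {(N : R)} ∨ 𝔮 ∣ 𝔞) :
    𝔮 ∣ Ideal.span {((N * Ideal.absNorm 𝔞 : ℕ) : R)} := by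
  rw [Ideal.dvd_span_singleton, Nat.cast_mul]
  rcases h with h | h
  · exact Ideal.mul_mem_right _ _ (Ideal.dvd_span_singleton.1 h)
  · exact Ideal.mul_mem_left _ _ (Ideal.dvd_iff_le.1 h (Ideal.absNorm_mem _))

section MainTheorem

variable {F : Type*} [Field F] [NumberField F] (E : WeierstrassCurve F) [E.IsElliptic] {N : ℕ}
  {α : Fˣ} {β : AlgebraicClosure F}

theorem isUnramifiedOutside_adjoin_of_twistImageMissesNegOne
    (hα : TwistImageMissesNegOne E N α) (hβ : β ^ 2 = algebraMap F (AlgebraicClosure F) α) :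
    IsUnramifiedOutside (Ideal.span {(N : 𝓞 F)} * conductor E) F⟮β⟯ :=
  (isUnramifiedOutside_divisionField E N).mono
    (adjoin_simple_le_iff.2 (mem_divisionField_of_twistImageMissesNegOne E hα hβ))

theorem dvd_or_dvd_conductor_of_ramifiesIn (hα : TwistImageMissesNegOne E N α)
    (hβ : β ^ 2 = algebraMap F (AlgebraicClosure F) α) {v : HeightOneSpectrum (𝓞 F)}
    (hv : RamifiesIn v F⟮β⟯) :
    v.asIdeal ∣ Ideal.span {(N : 𝓞 F)} ∨ v.asIdeal ∣ conductor E :=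
  v.prime.dvd_or_dvd <| isUnramifiedOutside_adjoin_of_twistImageMissesNegOne E hα hβ F⟮β⟯ le_rfl
    (adjoin.finiteDimensional (Algebra.IsIntegral.isIntegral β)) v hv

theorem mk_mem_selmerGroup_of_twistImageMissesNegOne (hα : TwistImageMissesNegOne E N α)
    {S : Set (HeightOneSpectrum (𝓞 F))}
    (hS : ∀ v : HeightOneSpectrum (𝓞 F),
      v.asIdeal ∣ Ideal.span {(N : 𝓞 F)} ∨ v.asIdeal ∣ conductor E → v ∈ S) :
    QuotientGroup.mk α ∈ selmerGroup (R := 𝓞 F) (K := F) (S := S) (n := 2) := by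
  obtain ⟨β, hβ⟩ := IsAlgClosed.exists_pow_nat_eq (algebraMap F (AlgebraicClosure F) α) two_pos
  exact mk_mem_selmerGroup_of_pow_eq hβ fun v hv ↦
    hS v (dvd_or_dvd_conductor_of_ramifiesIn E hα hβ hv)

theorem finite_setOf_twistImageMissesNegOne (hN : N ≠ 0) :
    {c : Fˣ ⧸ (powMonoidHom 2 : Fˣ →* Fˣ).range |
      ∃ α : Fˣ, TwistImageMissesNegOne E N α ∧ QuotientGroup.mk α = c}.Finite := by
  have hN0 : Ideal.span {(N : 𝓞 F)} ≠ 0 := by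
    rwa [Ne, Ideal.zero_eq_bot, Ideal.span_singleton_eq_bot, Nat.cast_eq_zero]
  have : Group.FG (𝓞 F)ˣ := Group.fg_iff_monoid_fg.2 inferInstance
  set S : Set (HeightOneSpectrum (𝓞 F)) :=
    {v | v.asIdeal ∣ Ideal.span {(N : 𝓞 F)}} ∪ {v | v.asIdeal ∣ conductor E}
  have := finite_selmerGroup (K := F) (S := S) (n := 2)
    ((Ideal.finite_factors hN0).union (Ideal.finite_factors (conductor_ne_zero E)))
  refine (SetLike.coe (selmerGroup (K := F) (S := S) (n := 2))).toFinite.subset ?_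
  rintro _ ⟨α, hα, rfl⟩
  exact mk_mem_selmerGroup_of_twistImageMissesNegOne E hα fun v hv ↦ hv

theorem exists_mem_twistSet_of_twistImageMissesNegOne
    (hclass : NumberField.classNumber F = 1) {n : ℕ} {p : Fin n → Ideal (𝓞 F)}
    {π : Fin n → 𝓞 F} {u : (𝓞 F)ˣ} (hp : Function.Injective p)
    (hrange : Set.range p = {q : Ideal (𝓞 F) | q.IsPrime ∧ q ≠ ⊥ ∧
      q ∣ Ideal.span {((N * Ideal.absNorm (conductor E) : ℕ) : 𝓞 F)}})
    (hπ : ∀ i, p i = Ideal.span {π i}) (hu : Subgroup.closure {-1, u} = ⊤)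
    (hα : TwistImageMissesNegOne E N α) :
    ∃ a ∈ twistSet u π, ∃ c : Fˣ, (α : F) = algebraMap (𝓞 F) F a * (c : F) ^ 2 := by
  have hpi (i : Fin n) : (p i).IsPrime ∧ p i ≠ ⊥ ∧ _ := hrange.subset (Set.mem_range_self i)
  let 𝔭 (i : Fin n) : HeightOneSpectrum (𝓞 F) := ⟨p i, (hpi i).1, (hpi i).2.1⟩
  have h𝔭 : Function.Injective 𝔭 := fun i j hij ↦ hp (congrArg HeightOneSpectrum.asIdeal hij)
  refine exists_mem_twistSet hclass h𝔭 hπ hu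
    (mk_mem_selmerGroup_of_twistImageMissesNegOne E hα fun v hv ↦ ?_)
  obtain ⟨i, hi⟩ := hrange.superset
    ⟨v.isPrime, v.ne_bot, dvd_span_natCast_mul_absNorm hv⟩
  exact ⟨i, HeightOneSpectrum.ext hi⟩

theorem mainTheorem10_general (hN : N ≠ 0) :
    (∀ α : Fˣ, TwistImageMissesNegOne E N α →
      ∀ β : AlgebraicClosure F, β ^ 2 = algebraMap F (AlgebraicClosure F) α →
        β ∈ divisionField E N) ∧
    (∀ α : Fˣ, TwistImageMissesNegOne E N α →
      ∀ β : AlgebraicClosure F, β ^ 2 = algebraMap F (AlgebraicClosure F) α →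
        ∀ v : HeightOneSpectrum (𝓞 F), RamifiesIn v F⟮β⟯ →
          v.asIdeal ∣ Ideal.span {(N : 𝓞 F)} ∨ v.asIdeal ∣ conductor E) ∧
    (∃ M : IntermediateField F (AlgebraicClosure F),
      IsGreatest {L : IntermediateField F (AlgebraicClosure F) | IsAbelianOfExponentTwo L ∧
        IsUnramifiedOutside (Ideal.span {(N : 𝓞 F)} * conductor E) L} M ∧
      ∀ α : Fˣ, TwistImageMissesNegOne E N α →
        ∀ β : AlgebraicClosure F, β ^ 2 = algebraMap F (AlgebraicClosure F) α → F⟮β⟯ ≤ M) ∧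
    {c : Fˣ ⧸ (powMonoidHom 2 : Fˣ →* Fˣ).range |
      ∃ α : Fˣ, TwistImageMissesNegOne E N α ∧ QuotientGroup.mk α = c}.Finite ∧
    (NumberField.classNumber F = 1 →
      ∀ (n : ℕ) (p : Fin n → Ideal (𝓞 F)) (π : Fin n → 𝓞 F) (u : (𝓞 F)ˣ),
        Function.Injective p →
        Set.range p = {q : Ideal (𝓞 F) | q.IsPrime ∧ q ≠ ⊥ ∧
          q ∣ Ideal.span {((N * Ideal.absNorm (conductor E) : ℕ) : 𝓞 F)}} →
        (∀ i, p i = Ideal.span {π i}) →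
        Subgroup.closure {-1, u} = ⊤ →
        ∀ α : Fˣ, TwistImageMissesNegOne E N α →
          ∃ a ∈ twistSet u π, ∃ c : Fˣ, (α : F) = algebraMap (𝓞 F) F a * (c : F) ^ 2) := by
  obtain ⟨M, hM⟩ := exists_isGreatest_isAbelianOfExponentTwo_isUnramifiedOutside
    (Ideal.span {(N : 𝓞 F)} * conductor E)
  exact ⟨fun α hα β hβ ↦ mem_divisionField_of_twistImageMissesNegOne E hα hβ,
    fun α hα β hβ v hv ↦ dvd_or_dvd_conductor_of_ramifiesIn E hα hβ hv,
    ⟨M, hM, fun α hα β hβ ↦ hM.2 ⟨isAbelianOfExponentTwo_adjoin_of_sq_eq hβ,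
      isUnramifiedOutside_adjoin_of_twistImageMissesNegOne E hα hβ⟩⟩,
    finite_setOf_twistImageMissesNegOne E hN,
    fun hclass n p π u hp hrange hπ hu α hα ↦
      exists_mem_twistSet_of_twistImageMissesNegOne E hclass hp hrange hπ hu hα⟩

end MainTheorem

end EllipticTwist

open EllipticTwist IsDedekindDomain in
theorem mainTheorem10 {F : Type*} [Field F] [NumberField F] (E : WeierstrassCurve F)
    [E.IsElliptic] (N : ℕ) (hN : 2 < N) :
    -- (1) `√α` lies in `F(E[N])`
    (∀ α : Fˣ, TwistImageMissesNegOne E N α →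
      ∀ β : AlgebraicClosure F, β ^ 2 = algebraMap F (AlgebraicClosure F) α →
        β ∈ divisionField E N) ∧
    -- (2) only primes dividing `N` or the conductor can ramify in `F(√α) / F`
    (∀ α : Fˣ, TwistImageMissesNegOne E N α →
      ∀ β : AlgebraicClosure F, β ^ 2 = algebraMap F (AlgebraicClosure F) α →
        ∀ v : HeightOneSpectrum (𝓞 F), RamifiesIn v (IntermediateField.adjoin F {β}) →
          v.asIdeal ∣ Ideal.span {(N : 𝓞 F)} ∨ v.asIdeal ∣ conductor E) ∧
    -- (3) `F(√α)` lies in the maximal abelian extension of exponent `2` unramified outside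
    -- the infinite places and the primes dividing `N` times the conductor
    (∃ M : IntermediateField F (AlgebraicClosure F),
      IsGreatest {L : IntermediateField F (AlgebraicClosure F) | IsAbelianOfExponentTwo L ∧
        IsUnramifiedOutside (Ideal.span {(N : 𝓞 F)} * conductor E) L} M ∧
      ∀ α : Fˣ, TwistImageMissesNegOne E N α →
        ∀ β : AlgebraicClosure F, β ^ 2 = algebraMap F (AlgebraicClosure F) α →
          IntermediateField.adjoin F {β} ≤ M) ∧
    -- (4) finitely many classes of `α` modulo squares
    {c : Fˣ ⧸ (powMonoidHom 2 : Fˣ →* Fˣ).range |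
      ∃ α : Fˣ, TwistImageMissesNegOne E N α ∧ (QuotientGroup.mk α) = c}.Finite ∧
    -- (5) real quadratic fields of class number one
    (Module.finrank ℚ F = 2 → NumberField.IsTotallyReal F → NumberField.classNumber F = 1 →
      ∀ (n : ℕ) (p : Fin n → Ideal (𝓞 F)) (π : Fin n → 𝓞 F) (u : (𝓞 F)ˣ),
        Function.Injective p →
        Set.range p = {q : Ideal (𝓞 F) | q.IsPrime ∧ q ≠ ⊥ ∧
          q ∣ Ideal.span {((N * Ideal.absNorm (conductor E) : ℕ) : 𝓞 F)}} →
        (∀ i, p i = Ideal.span {π i}) →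
        Subgroup.closure {-1, u} = ⊤ →
        ∀ α : Fˣ, TwistImageMissesNegOne E N α →
          ∃ a ∈ twistSet u π, ∃ c : Fˣ, (α : F) = algebraMap (𝓞 F) F a * (c : F) ^ 2) := by
  obtain ⟨h₁, h₂, h₃, h₄, h₅⟩ := mainTheorem10_general E (N := N) (by lia)
  exact ⟨h₁, h₂, h₃, h₄, fun _ _ ↦ h₅⟩
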